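/- **Model.** $n$ asynchronous sequential processes $p_1,\dots,p_n$ communicate through FIFO channels, one from each process to each process (itself included). Channels are reliable (no loss, corruption or creation of messages) and asynchronous: transit times are finite but unbounded. In each run at most $t$ processes crash (they are *faulty*), where $t<n/2$; a process follows its code until it possibly crashes, at any point, in particular in the middle of a sequence of sends. Non-faulty processes never stop executing their code. "fifo-broadcast $\mu$" means: send $\mu$ to each of the $n$ processes on the FIFO channels, in an arbitrary order. **SCD-broadcast.** Processes invoke $\mathsf{scd\_broadcast}(m)$ (each process has at most one pending invocation; all messages that are scd-broadcast are different) and scd-deliver non-empty sets of messages, such that: - *Validity*: if a process scd-delivers a set containing $m$, then $m$ was scd-broadcast by some process. - *Integrity*: a message is scd-delivered at most once by each process. - *MS-Ordering*: if a process scd-delivers a set containing $m$ and later another set containing $m'$, then no process scd-delivers a set containing $m'$ and later another set containing $m$. - *Termination-1*: if a non-faulty process scd-broadcasts $m$, its invocation terminates and it scd-delivers a set containing $m$. - *Termination-2*: if a non-faulty process scd-delivers $m$, then every non-faulty process scd-delivers a set containing $m$. **Algorithm** (code for $p_i$). Local variables: $buffer_i=\emptyset$; $sn_i=0$; $clock_i[1..n]$,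 with all entries initially smaller than every sequence number (e.g. $-1$). The bodies of the operation (up to its wait statement) and of the reception handler are executed without local interleaving. - *Operation* $\mathsf{scd\_broadcast}(m)$: call $\mathsf{forward}(m,i,sn_i,i,sn_i)$; then wait until no $msg\in buffer_i$ has $msg.sd=i$. - *When* $\mathrm{FORWARD}(m,sd,sn_{sd},f,sn_f)$ *is fifo-delivered*: call $\mathsf{forward}(m,sd,sn_{sd},f,sn_f)$, then $\mathsf{try\_deliver}()$. - *Procedure* $\mathsf{forward}(m,sd,sn_{sd},f,sn_f)$: if $sn_{sd}>clock_i[sd]$, then: if some $msg\in buffer_i$ has $msg.sd=sd$ and $msg.sn=sn_{sd}$, set $msg.cl[f]\leftarrow sn_f$; otherwise add to $buffer_i$ the quadruplet $\langle m,sd,sn_{sd},cl\rangle$ with $cl[f]=sn_f$ and $cl[x]=\infty$ for $x\ne f$, fifo-broadcast $\mathrm{FORWARD}(m,sd,sn_{sd},i,sn_i)$, and set $sn_i\leftarrow sn_i+1$. - *Procedure* $\mathsf{try\_deliver}()$: let $D=\{msg\in buffer_i : |\{f: msg.cl[f]<\infty\}|>n/2\}$; while there are $msg\in D$ and $msg'\in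 buffer_i\setminus D$ with $|\{f: msg.cl[f]<msg'.cl[f]\}|\le n/2$, remove such a $msg$ from $D$. If finally $D\neq\emptyset$: for each $msg\in D$ replace $clock_i[msg.sd]$ by $\max(clock_i[msg.sd],msg.sn)$; remove $D$ from $buffer_i$; scd-deliver the set $\{msg.m : msg\in D\}$. **Theorem.** For all $n$ and $t$ with $t<n/2$, every run of this algorithm in this model satisfies Validity, Integrity, MS-Ordering, Termination-1 and Termination-2, i.e. the algorithm implements SCD-broadcast. Moreover it requires $O(n^2)$ protocol messages per invocation of $\mathsf{scd\_broadcast}$: there is a constant $C$, independent of $n$, $t$ and the run, such that every protocol message carries an application message that was scd-broadcast before, and for each invocation of $\mathsf{scd\_broadcast}(m)$ at most $Cn^2$ protocol messages carrying $m$ are sent in the whole run (a message sent to $n$ processes counting $n$ times). -/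

import Mathlib

namespace SCD

noncomputable section

universe u

/-! ## The SCD-broadcast abstraction -/

/-- Events at the interface of SCD-broadcast, for `n` processes and application messages in `M`. -/
inductive ScdEvent (n : ℕ) (M : Type u) : Type u
  /-- process `i` invokes scd-broadcast(m) -/
  | broadcast (i : Fin n) (m : M)
  /-- the invocation of scd-broadcast(m) by process `i` terminates -/
  | returns (i : Fin n) (m : M)
  /-- process `i` scd-delivers the message set `ms` -/
  | deliver (i : Fin n) (ms : Finset M)

/-- `IsScdBroadcast h faulty`: the history `h` (at each time at most one interface event)
satisfies the specification of SCD-broadcast, the set of faulty processes being `faulty`. -/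
structure IsScdBroadcast {n : ℕ} {M : Type u}
    (h : ℕ → Option (ScdEvent n M)) (faulty : Set (Fin n)) : Prop where
  /-- Only non-empty message sets are delivered. -/
  nonempty : ∀ τ i ms, h τ = some (.deliver i ms) → ms.Nonempty
  /-- Validity. -/
  validity : ∀ τ i ms m, h τ = some (.deliver i ms) → m ∈ ms →
    ∃ τ' < τ, ∃ j, h τ' = some (.broadcast j m)
  /-- Integrity: no process delivers the same message twice. -/
  integrity : ∀ τ τ' i ms ms' m, h τ = some (.deliver i ms) → h τ' = some (.deliver i ms') →
    m ∈ ms → m ∈ ms' → τ = τ'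
  /-- MS-Ordering: if `i` delivers `m` and, in a later set, `m'`, then no process `j` delivers
  `m'` and, in a later set, `m`. -/
  msOrdering : ∀ i j m m' τ₁ τ₂ τ₃ τ₄ A B C D,
    h τ₁ = some (.deliver i A) → m ∈ A → h τ₂ = some (.deliver i B) → m' ∈ B → τ₁ < τ₂ →
    h τ₃ = some (.deliver j C) → m' ∈ C → h τ₄ = some (.deliver j D) → m ∈ D → ¬ τ₃ < τ₄
  /-- Termination-1. -/
  termination1 : ∀ τ i m, i ∉ faulty → h τ = some (.broadcast i m) →
    (∃ τ' > τ, h τ' = some (.returns i m)) ∧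
    (∃ τ' ms, h τ' = some (.deliver i ms) ∧ m ∈ ms)
  /-- Termination-2. -/
  termination2 : ∀ τ i ms m, i ∉ faulty → h τ = some (.deliver i ms) → m ∈ ms →
    ∀ j, j ∉ faulty → ∃ τ' ms', h τ' = some (.deliver j ms') ∧ m ∈ ms'

/-! ## Data of the algorithm -/

/-- The protocol message FORWARD(m, sd, snsd, f, snf). -/
structure Forward (n : ℕ) (M : Type u) : Type u where
  m : M
  sd : Fin n
  snsd : ℕ
  f : Fin n
  snf : ℕ

/-- The quadruplets ⟨m, sd, sn, cl⟩ kept in the local buffers. -/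
structure Quadruplet (n : ℕ) (M : Type u) : Type u where
  m : M
  sd : Fin n
  sn : ℕ
  cl : Fin n → ℕ∞

/-- The two places from which the procedure `forward` is called. -/
inductive Caller
  | operation
  | handler

/-- Control point of a process. -/
inductive Control (n : ℕ) (M : Type u) : Type u
  /-- between two pieces of local code (outside any operation, or waiting inside scd-broadcast) -/
  | ready
  /-- inside `forward`, in the middle of fifo-broadcasting `μ`, which remains to be sent to the
  processes in `dests` -/
  | sending (μ : Forward n M) (dests : Finset (Fin n)) (c : Caller)
  /-- in the reception handler, about to execute `try_deliver` -/
  | delivering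

/-- What follows a call of `forward`: the operation goes to its wait statement (in which the
handler may run), the handler goes to `try_deliver`. -/
def Caller.next {n : ℕ} {M : Type u} : Caller → Control n M
  | .operation => .ready
  | .handler => .delivering

/-- Local state of a process. -/
structure LocalState (n : ℕ) (M : Type u) : Type u where
  buffer : Finset (Quadruplet n M)
  sn : ℕ
  /-- `clock j` is the greatest sequence number of the messages of `j` delivered so far,
  `⊥` if there is none -/
  clock : Fin n → WithBot ℕ
  /-- the message of the current scd-broadcast invocation, if there is one -/
  op : Option M
  control : Control n M
  crashed : Bool

/-- Global state: local states, and contents of the FIFO channels, `chan i j` being the channel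
from `i` to `j`, with the oldest message first. -/
structure Config (n : ℕ) (M : Type u) : Type u where
  loc : Fin n → LocalState n M
  chan : Fin n → Fin n → List (Forward n M)

def initialLocal (n : ℕ) (M : Type u) : LocalState n M where
  buffer := ∅
  sn := 0
  clock := fun _ => ⊥
  op := none
  control := .ready
  crashed := false

def initialConfig (n : ℕ) (M : Type u) : Config n M where
  loc := fun _ => initialLocal n M
  chan := fun _ _ => []

def Config.setLoc {n : ℕ} {M : Type u} (c : Config n M) (i : Fin n) (s : LocalState n M) :
    Config n M :=
  { c with loc := Function.update c.loc i s }

def Config.setChan {n : ℕ} {M : Type u} (c : Config n M) (i j : Fin n)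
    (l : List (Forward n M)) : Config n M :=
  { c with chan := Function.update c.chan i (Function.update (c.chan i) j l) }

/-! ## Local code -/

open Classical in
/-- Procedure `forward(m, sd, snsd, f, snf)` at process `i` up to the point where the
fifo-broadcast (if any) starts. The sends and the increment of `sn` are separate steps. -/
def forward {n : ℕ} {M : Type u} (i : Fin n) (s : LocalState n M) (μ : Forward n M)
    (c : Caller) : LocalState n M :=
  if s.clock μ.sd < (μ.snsd : WithBot ℕ) then
    if ∃ q ∈ s.buffer, q.sd = μ.sd ∧ q.sn = μ.snsd then
      { s with
        buffer := s.buffer.image fun q =>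
          if q.sd = μ.sd ∧ q.sn = μ.snsd then
            { q with cl := Function.update q.cl μ.f (μ.snf : ℕ∞) }
          else q
        control := c.next }
    else
      { s with
        buffer := insert
          ⟨μ.m, μ.sd, μ.snsd, Function.update (fun _ => (⊤ : ℕ∞)) μ.f (μ.snf : ℕ∞)⟩ s.buffer
        control := .sending ⟨μ.m, μ.sd, μ.snsd, i, s.sn⟩ Finset.univ c }
  else
    { s with control := c.next }

open Classical in
/-- Local state once the pending message has been sent to `j`; the last send is followed by the
increment of `sn`. -/
def afterSend {n : ℕ} {M : Type u} (s : LocalState n M) (μ : Forward n M)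
    (dests : Finset (Fin n)) (c : Caller) (j : Fin n) : LocalState n M :=
  if dests.erase j = ∅ then
    { s with sn := s.sn + 1, control := c.next }
  else
    { s with control := .sending μ (dests.erase j) c }

open Classical in
/-- The quadruplets of the buffer whose message was seen by a majority of processes. -/
def candidates {n : ℕ} {M : Type u} (B : Finset (Quadruplet n M)) : Finset (Quadruplet n M) :=
  B.filter fun q => n < 2 * (Finset.univ.filter fun f => q.cl f < ⊤).card

open Classical in
/-- One iteration of the while loop of `try_deliver`, with buffer `B`: a quadruplet `q` is
withdrawn from the current value `T` of `to_deliver`, leading to `T'`. -/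
def PurgeStep {n : ℕ} {M : Type u} (B T T' : Finset (Quadruplet n M)) : Prop :=
  ∃ q ∈ T, ∃ q' ∈ B \ T,
    2 * (Finset.univ.filter fun f => q.cl f < q'.cl f).card ≤ n ∧ T' = T.erase q

/-- `T` is a possible value of `to_deliver` at the end of the while loop. -/
def ToDeliver {n : ℕ} {M : Type u} (B T : Finset (Quadruplet n M)) : Prop :=
  Relation.ReflTransGen (PurgeStep B) (candidates B) T ∧ ∀ T', ¬ PurgeStep B T T'

open Classical in
/-- Local state after a `try_deliver` whose while loop ends with `to_deliver = T`. -/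
def afterTryDeliver {n : ℕ} {M : Type u} (s : LocalState n M) (T : Finset (Quadruplet n M)) :
    LocalState n M :=
  { s with
    buffer := s.buffer \ T
    clock := fun j =>
      s.clock j ⊔ (T.filter fun q => q.sd = j).sup fun q => (q.sn : WithBot ℕ)
    control := .ready }

open Classical in
/-- The set of application messages carried by `T`. -/
def messages {n : ℕ} {M : Type u} (T : Finset (Quadruplet n M)) : Finset M :=
  T.image fun q => q.m

/-! ## Runs -/

inductive Action (n : ℕ) (M : Type u) : Type u
  /-- `i` invokes scd-broadcast(m) -/
  | invoke (i : Fin n) (m : M)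
  /-- the wait statement of scd-broadcast(m) ends at `i`, and the invocation terminates -/
  | ret (i : Fin n) (m : M)
  /-- `j` fifo-delivers the oldest message of the channel from `i` -/
  | receive (i j : Fin n)
  /-- `i` sends `μ` to `j` -/
  | send (i j : Fin n) (μ : Forward n M)
  /-- `i` executes `try_deliver` and scd-delivers `ms` -/
  | scdDeliver (i : Fin n) (ms : Finset M)
  /-- `i` executes `try_deliver` without delivering anything -/
  | noDeliver (i : Fin n)
  /-- `i` crashes -/
  | crash (i : Fin n)
  /-- nothing happens -/
  | idle

/-- One step of the system. A process that has crashed takes no step. -/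
inductive Step {n : ℕ} {M : Type u} : Config n M → Action n M → Config n M → Prop
  | invoke (c : Config n M) (i : Fin n) (m : M) :
      (c.loc i).crashed = false → (c.loc i).control = .ready → (c.loc i).op = none →
      Step c (.invoke i m)
        (c.setLoc i (forward i { c.loc i with op := some m }
          ⟨m, i, (c.loc i).sn, i, (c.loc i).sn⟩ .operation))
  | ret (c : Config n M) (i : Fin n) (m : M) :
      (c.loc i).crashed = false → (c.loc i).control = .ready → (c.loc i).op = some m →
      (¬ ∃ q ∈ (c.loc i).buffer, q.sd = i) →
      Step c (.ret i m) (c.setLoc i { c.loc i with op := none })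
  | receive (c : Config n M) (i j : Fin n) (μ : Forward n M) (l : List (Forward n M)) :
      (c.loc j).crashed = false → (c.loc j).control = .ready → c.chan i j = μ :: l →
      Step c (.receive i j) ((c.setChan i j l).setLoc j (forward j (c.loc j) μ .handler))
  | send (c : Config n M) (i j : Fin n) (μ : Forward n M) (dests : Finset (Fin n))
      (k : Caller) :
      (c.loc i).crashed = false → (c.loc i).control = .sending μ dests k → j ∈ dests →
      Step c (.send i j μ)
        ((c.setChan i j (c.chan i j ++ [μ])).setLoc i (afterSend (c.loc i) μ dests k j))
  | scdDeliver (c : Config n M) (i : Fin n) (T : Finset (Quadruplet n M)) :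
      (c.loc i).crashed = false → (c.loc i).control = .delivering →
      ToDeliver (c.loc i).buffer T → T ≠ ∅ →
      Step c (.scdDeliver i (messages T)) (c.setLoc i (afterTryDeliver (c.loc i) T))
  | noDeliver (c : Config n M) (i : Fin n) :
      (c.loc i).crashed = false → (c.loc i).control = .delivering →
      ToDeliver (c.loc i).buffer ∅ →
      Step c (.noDeliver i) (c.setLoc i { c.loc i with control := .ready })
  | crash (c : Config n M) (i : Fin n) :
      (c.loc i).crashed = false →
      Step c (.crash i) (c.setLoc i { c.loc i with crashed := true })
  | idle (c : Config n M) : Step c .idle c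

/-- An infinite sequence of steps of the system from its initial state (a finite execution is
followed by idle steps). -/
structure Run (n : ℕ) (M : Type u) : Type u where
  state : ℕ → Config n M
  act : ℕ → Action n M
  start : state 0 = initialConfig n M
  step : ∀ τ, Step (state τ) (act τ) (state (τ + 1))

/-- The processes that crash in the run. -/
def Run.faulty {n : ℕ} {M : Type u} (ρ : Run n M) : Set (Fin n) :=
  {i | ∃ τ, ρ.act τ = .crash i}

/-- Asynchrony without starvation: transit times are finite, and a non-faulty process never stops
executing its code. -/
structure Run.IsFair {n : ℕ} {M : Type u} (ρ : Run n M) : Prop where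
  /-- A non-faulty process eventually fifo-delivers what is in its incoming channels. -/
  receive : ∀ τ i j, j ∉ ρ.faulty → (ρ.state τ).chan i j ≠ [] →
    ∃ τ' ≥ τ, ρ.act τ' = .receive i j
  /-- A non-faulty process eventually sends the message it is fifo-broadcasting to each of the
  remaining destinations. -/
  send : ∀ τ i μ dests k, i ∉ ρ.faulty → ((ρ.state τ).loc i).control = .sending μ dests k →
    ∀ j ∈ dests, ∃ τ' ≥ τ, ρ.act τ' = .send i j μ
  /-- A non-faulty process eventually executes a pending `try_deliver`. -/
  deliver : ∀ τ i, i ∉ ρ.faulty → ((ρ.state τ).loc i).control = .delivering →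
    ∃ τ' ≥ τ, ρ.act τ' = .noDeliver i ∨ ∃ ms, ρ.act τ' = .scdDeliver i ms
  /-- The wait statement of a non-faulty process ends if its condition is true from some time
  on. -/
  ret : ∀ τ i m, i ∉ ρ.faulty → ((ρ.state τ).loc i).op = some m →
    (∀ τ' ≥ τ, ¬ ∃ q ∈ ((ρ.state τ').loc i).buffer, q.sd = i) →
    ∃ τ' ≥ τ, ρ.act τ' = .ret i m

/-- All the messages that are scd-broadcast are different. -/
def Run.DistinctBroadcasts {n : ℕ} {M : Type u} (ρ : Run n M) : Prop :=
  ∀ τ τ' i i' m, ρ.act τ = .invoke i m → ρ.act τ' = .invoke i' m → τ = τ'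

def Action.toScdEvent {n : ℕ} {M : Type u} : Action n M → Option (ScdEvent n M)
  | .invoke i m => some (.broadcast i m)
  | .ret i m => some (.returns i m)
  | .scdDeliver i ms => some (.deliver i ms)
  | _ => none

/-- The history of the run at the interface of SCD-broadcast. -/
def Run.history {n : ℕ} {M : Type u} (ρ : Run n M) : ℕ → Option (ScdEvent n M) :=
  fun τ => (ρ.act τ).toScdEvent

/-- Every protocol message sent in the run is due to an earlier invocation of scd-broadcast,
namely that of the application message it carries, and at most `b` protocol messages are sent in
the whole run for each invocation. A message sent to `n` processes counts `n` times. -/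
def Run.CostPerBroadcastLE {n : ℕ} {M : Type u} (ρ : Run n M) (b : ℕ) : Prop :=
  (∀ τ i j μ, ρ.act τ = .send i j μ → ∃ τ' < τ, ρ.act τ' = .invoke μ.sd μ.m) ∧
  ∀ τ i m, ρ.act τ = .invoke i m →
    {τ' | ∃ j k μ, ρ.act τ' = .send j k μ ∧ μ.m = m}.encard ≤ (b : ℕ∞)

end

end SCD

namespace SCD

noncomputable section

universe u

variable {n : ℕ} {M : Type u}

/-! Every process numbers the messages that it forwards, and the proof compares these local orders.
A process forwards a given key at most once, with increasing numbers, and a finite entry `cl f` in a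
buffer is the number given by `f`. `Prec f x y` says that `x` comes first, as against `y`, in the
order of `f`.

Safety. FIFO channels carry the order of a sender to everyone who forwards its messages
(`Fwd.causal`). It follows that clocks reject no message still in the buffer and that entries are
faithful (`clk_lt_and_cl_of_rcv`). Hence a process that delivers `x` while `y` remains undelivered
has `Prec f x y` for a majority of `f` (`majority_prec`). Opposite delivery orders would give two
majorities with a common process, against the asymmetry of `Prec`.

Liveness. Call a message stuck at `i` if `i` forwards it and never delivers it. A finite nonempty
set of stuck messages that precede all other stuck ones at a majority of non-faulty processes cannot
exist: the purge loop of a late `try_deliver` could withdraw none of them (`not_forall_stuck`). So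
finitely many stuck messages are impossible. If there are infinitely many, one chooses a stuck `y`,
not the last message of its sender, outside a finite exceptional set. The sender has invoked again,
so it has delivered `y`; the stuck messages that it had delivered by then form a finite set, and
what it delivered precedes, at a majority, what it had not. Faulty members of these majorities
matter only for the finitely many messages that faulty processes forward, and the exceptional set
takes care of those (`not_stuck`).

Cost. A message travels at most once on each of the `n ^ 2` channels (`send_unique`). -/

/-- The identity of an application message: its sender and its sequence number. -/
def Forward.key (μ : Forward n M) : Fin n × ℕ := (μ.sd, μ.snsd)

/-- The identity of the application message of a quadruplet. -/
def Quadruplet.key (q : Quadruplet n M) : Fin n × ℕ := (q.sd, q.sn)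

/-! ### Observables of a run, and its steps seen from one process or one channel -/

namespace Run

variable (ρ : Run n M)

abbrev buf (τ : ℕ) (i : Fin n) : Finset (Quadruplet n M) := ((ρ.state τ).loc i).buffer
abbrev sn (τ : ℕ) (i : Fin n) : ℕ := ((ρ.state τ).loc i).sn
abbrev clk (τ : ℕ) (i : Fin n) : Fin n → WithBot ℕ := ((ρ.state τ).loc i).clock
abbrev op (τ : ℕ) (i : Fin n) : Option M := ((ρ.state τ).loc i).op
abbrev ctl (τ : ℕ) (i : Fin n) : Control n M := ((ρ.state τ).loc i).control
abbrev chan (τ : ℕ) (i j : Fin n) : List (Forward n M) := (ρ.state τ).chan i j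

/-- By time `τ`, process `i` has started to fifo-broadcast `μ`. -/
def Fwd (τ : ℕ) (i : Fin n) (μ : Forward n M) : Prop :=
  ∃ τ' ≤ τ, ∃ d k, ρ.ctl τ' i = .sending μ d k

/-- Before time `τ`, process `j` has fifo-delivered `μ` from process `i`. -/
def Rcv (τ : ℕ) (i j : Fin n) (μ : Forward n M) : Prop :=
  ∃ τ' < τ, ρ.act τ' = .receive i j ∧ ∃ l, ρ.chan τ' i j = μ :: l

/-- `x` is the identity of a quadruplet in the buffer of `i` at time `τ`. -/
def InBuf (τ : ℕ) (i : Fin n) (x : Fin n × ℕ) : Prop := ∃ q ∈ ρ.buf τ i, q.key = x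

/-- At time `τ` process `i` calls `forward` with `μ`. -/
def Call (τ : ℕ) (i : Fin n) (μ : Forward n M) (k : Caller) : Prop :=
  (k = .operation ∧ ρ.act τ = .invoke i μ.m ∧ μ.sd = i ∧ μ.snsd = ρ.sn τ i ∧ μ.f = i ∧
    μ.snf = ρ.sn τ i ∧ ρ.op τ i = none ∧ ρ.op (τ + 1) i = some μ.m) ∨
  (k = .handler ∧ (∃ f, ρ.act τ = .receive f i ∧ ∃ l, ρ.chan τ f i = μ :: l) ∧
    ρ.op (τ + 1) i = ρ.op τ i)

open Classical in
/-- The possible evolutions of the state of process `i` in the step at time `τ`. -/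
inductive LocalCase (τ : ℕ) (i : Fin n) : Prop
  | quiet (hb : ρ.buf (τ + 1) i = ρ.buf τ i) (hs : ρ.sn (τ + 1) i = ρ.sn τ i)
      (hc : ρ.clk (τ + 1) i = ρ.clk τ i) (ho : ρ.op (τ + 1) i = ρ.op τ i)
      (hk : ρ.ctl (τ + 1) i = ρ.ctl τ i) (hr : ∀ f, ρ.act τ ≠ .receive f i)
      (hd : ∀ f μ, ρ.act τ ≠ .send i f μ)
  | ret (m : M) (ha : ρ.act τ = .ret i m) (hb : ρ.buf (τ + 1) i = ρ.buf τ i)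
      (hs : ρ.sn (τ + 1) i = ρ.sn τ i)
      (hc : ρ.clk (τ + 1) i = ρ.clk τ i) (ho : ρ.op (τ + 1) i = none)
      (hk : ρ.ctl (τ + 1) i = ρ.ctl τ i) (hq : ∀ q ∈ ρ.buf τ i, q.sd ≠ i)
  | drop (μ : Forward n M) (k : Caller) (ha : ρ.Call τ i μ k) (hrd : ρ.ctl τ i = .ready)
      (hle : (μ.snsd : WithBot ℕ) ≤ ρ.clk τ i μ.sd) (hb : ρ.buf (τ + 1) i = ρ.buf τ i)
      (hs : ρ.sn (τ + 1) i = ρ.sn τ i) (hc : ρ.clk (τ + 1) i = ρ.clk τ i)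
      (hk : ρ.ctl (τ + 1) i = k.next)
  | update (μ : Forward n M) (k : Caller) (ha : ρ.Call τ i μ k) (hrd : ρ.ctl τ i = .ready)
      (hlt : ρ.clk τ i μ.sd < (μ.snsd : WithBot ℕ)) (hin : ρ.InBuf τ i μ.key)
      (hb : ∀ q', q' ∈ ρ.buf (τ + 1) i ↔ ∃ q ∈ ρ.buf τ i, q' = if q.key = μ.key then
        { q with cl := Function.update q.cl μ.f (μ.snf : ℕ∞) } else q)
      (hs : ρ.sn (τ + 1) i = ρ.sn τ i) (hc : ρ.clk (τ + 1) i = ρ.clk τ i)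
      (hk : ρ.ctl (τ + 1) i = k.next)
  | start (μ : Forward n M) (k : Caller) (ha : ρ.Call τ i μ k) (hrd : ρ.ctl τ i = .ready)
      (hlt : ρ.clk τ i μ.sd < (μ.snsd : WithBot ℕ)) (hin : ¬ ρ.InBuf τ i μ.key)
      (hb : ∀ q', q' ∈ ρ.buf (τ + 1) i ↔ q' = ⟨μ.m, μ.sd, μ.snsd,
        Function.update (fun _ => (⊤ : ℕ∞)) μ.f (μ.snf : ℕ∞)⟩ ∨ q' ∈ ρ.buf τ i)
      (hs : ρ.sn (τ + 1) i = ρ.sn τ i) (hc : ρ.clk (τ + 1) i = ρ.clk τ i)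
      (hk : ρ.ctl (τ + 1) i = .sending ⟨μ.m, μ.sd, μ.snsd, i, ρ.sn τ i⟩ Finset.univ k)
  | send (j : Fin n) (μ : Forward n M) (d : Finset (Fin n)) (k : Caller)
      (ha : ρ.act τ = .send i j μ) (hk : ρ.ctl τ i = .sending μ d k) (hj : j ∈ d)
      (hb : ρ.buf (τ + 1) i = ρ.buf τ i) (hc : ρ.clk (τ + 1) i = ρ.clk τ i)
      (ho : ρ.op (τ + 1) i = ρ.op τ i)
      (hk' : (d.erase j = ∅ ∧ ρ.ctl (τ + 1) i = k.next ∧ ρ.sn (τ + 1) i = ρ.sn τ i + 1) ∨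
        (d.erase j ≠ ∅ ∧ ρ.ctl (τ + 1) i = .sending μ (d.erase j) k ∧
          ρ.sn (τ + 1) i = ρ.sn τ i))
  | deliver (T : Finset (Quadruplet n M)) (hT : ToDeliver (ρ.buf τ i) T)
      (ha : (ρ.act τ = .scdDeliver i (messages T) ∧ T ≠ ∅) ∨ (ρ.act τ = .noDeliver i ∧ T = ∅))
      (hk : ρ.ctl τ i = .delivering) (hk' : ρ.ctl (τ + 1) i = .ready)
      (hb : ∀ q, q ∈ ρ.buf (τ + 1) i ↔ q ∈ ρ.buf τ i ∧ q ∉ T)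
      (hc : ∀ j, ρ.clk (τ + 1) i j = ρ.clk τ i j ⊔
        (T.filter fun q => q.sd = j).sup fun q => (q.sn : WithBot ℕ))
      (hs : ρ.sn (τ + 1) i = ρ.sn τ i) (ho : ρ.op (τ + 1) i = ρ.op τ i)

theorem localCase_of_forward {τ : ℕ} {i : Fin n} {s : LocalState n M} {μ : Forward n M}
    {k : Caller} (hloc : (ρ.state (τ + 1)).loc i = forward i s μ k)
    (hs : s.buffer = ρ.buf τ i ∧ s.sn = ρ.sn τ i ∧ s.clock = ρ.clk τ i)
    (ha : ρ.Call τ i μ k) (hrd : ρ.ctl τ i = .ready) : ρ.LocalCase τ i := by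
  classical
  obtain ⟨h1, h2, h3⟩ := hs
  unfold forward at hloc
  have hkey : ∀ q : Quadruplet n M, (q.sd = μ.sd ∧ q.sn = μ.snsd) ↔ q.key = μ.key := by
    intro q; simp [Quadruplet.key, Forward.key]
  split_ifs at hloc with hlt hin
  · refine .update μ k ha hrd (h3 ▸ hlt) ?_ ?_ ?_ ?_ ?_
    · obtain ⟨q, hq, hq'⟩ := hin
      exact ⟨q, h1 ▸ hq, (hkey q).1 hq'⟩
    · intro q'
      simp only [buf, hloc, Finset.mem_image, h1]
      constructor
      · rintro ⟨q, hq, rfl⟩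
        exact ⟨q, hq, if_congr (hkey q) rfl rfl⟩
      · rintro ⟨q, hq, rfl⟩
        exact ⟨q, hq, if_congr (hkey q) rfl rfl⟩
    all_goals simp [sn, clk, ctl, hloc, h2, h3]
  · refine .start μ k ha hrd (h3 ▸ hlt) ?_ ?_ ?_ ?_ ?_
    · rintro ⟨q, hq, hq'⟩
      exact hin ⟨q, h1 ▸ hq, (hkey q).2 hq'⟩
    · intro q'
      simp only [buf, hloc, Finset.mem_insert, h1]
    all_goals simp [sn, clk, ctl, hloc, h2, h3]
  · refine .drop μ k ha hrd (h3 ▸ not_lt.1 hlt) ?_ ?_ ?_ ?_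
    all_goals simp [buf, sn, clk, ctl, hloc, h1, h2, h3]

/-- Most invariants below concern one process; this case split, with `chan_succ` for channels,
replaces inspection of the global step relation. The case `quiet` also absorbs the steps of other
processes and crashes. -/
theorem localCase (τ : ℕ) (i : Fin n) : ρ.LocalCase τ i := by
  classical
  have hst := ρ.step τ
  generalize hc : ρ.state τ = c at hst
  generalize hc' : ρ.state (τ + 1) = c' at hst
  generalize ha : ρ.act τ = a at hst
  have quiet : c'.loc i = c.loc i → (∀ f, a ≠ .receive f i) → (∀ f μ, a ≠ .send i f μ) →
      ρ.LocalCase τ i := by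
    intro h h1 h2
    refine .quiet ?_ ?_ ?_ ?_ ?_ (ha ▸ h1) (ha ▸ h2) <;>
      simp [buf, sn, clk, op, ctl, hc, hc', h]
  cases hst with
  | invoke i' m hcr hrd hop =>
    by_cases h : i = i'
    · subst h
      refine localCase_of_forward ρ (by rw [hc']; simp [Config.setLoc]; rfl)
        (by simp [buf, sn, clk, hc]) ?_ (by simpa [ctl, hc] using hrd)
      refine .inl ⟨rfl, ha, rfl, ?_, rfl, ?_, ?_, ?_⟩
      · simp [sn, hc]
      · simp [sn, hc]
      · simp [op, hc, hop]
      · simp only [op, hc', Config.setLoc, Function.update_self, forward]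
        split_ifs <;> rfl
    · exact quiet (by simp [Config.setLoc, h]) (by simp) (by simp)
  | ret i' m hcr hrd hop hq =>
    by_cases h : i = i'
    · subst h
      refine .ret m ha ?_ ?_ ?_ ?_ ?_ ?_
      · simp [buf, hc, hc', Config.setLoc]
      · simp [sn, hc, hc', Config.setLoc]
      · simp [clk, hc, hc', Config.setLoc]
      · simp [op, hc', Config.setLoc]
      · simp [ctl, hc, hc', Config.setLoc]
      · intro q hq' hsd
        exact hq ⟨q, by simpa [buf, hc] using hq', hsd⟩
    · exact quiet (by simp [Config.setLoc, h]) (by simp) (by simp)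
  | receive j i' μ l hcr hrd hch =>
    by_cases h : i = i'
    · subst h
      refine localCase_of_forward ρ (by rw [hc']; simp [Config.setLoc]; rfl)
        (by simp [buf, sn, clk, hc]) ?_ (by simpa [ctl, hc] using hrd)
      refine .inr ⟨rfl, ⟨j, ha, l, ?_⟩, ?_⟩
      · simp [chan, hc, hch]
      · simp only [op, hc, hc', Config.setLoc, Function.update_self, forward]
        split_ifs <;> rfl
    · refine quiet (by simp [Config.setLoc, Config.setChan, h]) ?_ (by simp)
      intro f hf
      injection hf with h1 h2
      exact h h2.symm
  | send i' j μ d k hcr hctl hj =>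
    by_cases h : i = i'
    · subst h
      refine .send j μ d k ha ?_ hj ?_ ?_ ?_ ?_
      · simp [ctl, hc, hctl]
      · simp only [buf, hc, hc', Config.setLoc, Function.update_self, afterSend]
        split_ifs <;> rfl
      · simp only [clk, hc, hc', Config.setLoc, Function.update_self, afterSend]
        split_ifs <;> rfl
      · simp only [op, hc, hc', Config.setLoc, Function.update_self, afterSend]
        split_ifs <;> rfl
      · simp only [ctl, sn, hc, hc', Config.setLoc, Function.update_self, afterSend]
        split_ifs with he
        · exact .inl ⟨by convert he, rfl, rfl⟩
        · exact .inr ⟨by convert he, by congr!, rfl⟩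
    · refine quiet (by simp [Config.setLoc, Config.setChan, h]) (by simp) ?_
      intro f μ' hf
      injection hf with h1 h2
      exact h h1.symm
  | scdDeliver i' T hcr hctl hT hne =>
    by_cases h : i = i'
    · subst h
      refine .deliver T (by simpa [buf, hc] using hT) (.inl ⟨ha, hne⟩) (by simp [ctl, hc, hctl])
        ?_ ?_ ?_ ?_ ?_
      · simp [ctl, hc', Config.setLoc, afterTryDeliver]
      · intro q
        simp [buf, hc, hc', Config.setLoc, afterTryDeliver]
      · intro j
        simp only [clk, hc, hc', Config.setLoc, afterTryDeliver, Function.update_self]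
      · simp [sn, hc, hc', Config.setLoc, afterTryDeliver]
      · simp [op, hc, hc', Config.setLoc, afterTryDeliver]
    · exact quiet (by simp [Config.setLoc, h]) (by simp) (by simp)
  | noDeliver i' hcr hctl hT =>
    by_cases h : i = i'
    · subst h
      refine .deliver ∅ (by simpa [buf, hc] using hT) (.inr ⟨ha, rfl⟩) (by simp [ctl, hc, hctl])
        ?_ ?_ ?_ ?_ ?_
      · simp [ctl, hc', Config.setLoc]
      · intro q
        simp [buf, hc, hc', Config.setLoc]
      · intro j
        simp [clk, hc, hc', Config.setLoc]
      · simp [sn, hc, hc', Config.setLoc]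
      · simp [op, hc, hc', Config.setLoc]
    · exact quiet (by simp [Config.setLoc, h]) (by simp) (by simp)
  | crash i' hcr =>
    by_cases h : i = i'
    · subst h
      refine .quiet ?_ ?_ ?_ ?_ ?_ (by simp [ha]) (by simp [ha]) <;>
        simp [buf, sn, clk, op, ctl, hc, hc', Config.setLoc]
    · exact quiet (by simp [Config.setLoc, h]) (by simp) (by simp)
  | idle => exact quiet rfl (by simp) (by simp)

/-- The possible evolutions of a channel in one step. -/
theorem chan_succ (τ : ℕ) (i j : Fin n) :
    (ρ.chan (τ + 1) i j = ρ.chan τ i j ∧ ρ.act τ ≠ .receive i j ∧ ∀ μ, ρ.act τ ≠ .send i j μ) ∨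
    (∃ μ, ρ.act τ = .receive i j ∧ ρ.chan τ i j = μ :: ρ.chan (τ + 1) i j) ∨
    (∃ μ, ρ.act τ = .send i j μ ∧ ρ.chan (τ + 1) i j = ρ.chan τ i j ++ [μ]) := by
  have hst := ρ.step τ
  generalize hc : ρ.state τ = c at hst
  generalize hc' : ρ.state (τ + 1) = c' at hst
  generalize ha : ρ.act τ = a at hst
  simp only [chan, hc, hc']
  cases hst with
  | receive i' j' μ l hcr hrd hch =>
    by_cases h : i = i' ∧ j = j'
    · obtain ⟨rfl, rfl⟩ := h
      exact .inr (.inl ⟨μ, rfl, by simp [Config.setLoc, Config.setChan, hch]⟩)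
    · refine .inl ⟨?_, ?_, by simp⟩
      · by_cases h1 : i = i'
        · subst h1
          have h2 : j ≠ j' := fun h2 => h ⟨rfl, h2⟩
          simp [Config.setLoc, Config.setChan, h2]
        · simp [Config.setLoc, Config.setChan, h1]
      · intro he
        injection he with h1 h2
        exact h ⟨h1.symm, h2.symm⟩
  | send i' j' μ d k hcr hctl hj =>
    by_cases h : i = i' ∧ j = j'
    · obtain ⟨rfl, rfl⟩ := h
      exact .inr (.inr ⟨μ, rfl, by simp [Config.setLoc, Config.setChan]⟩)
    · refine .inl ⟨?_, by simp, ?_⟩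
      · by_cases h1 : i = i'
        · subst h1
          have h2 : j ≠ j' := fun h2 => h ⟨rfl, h2⟩
          simp [Config.setLoc, Config.setChan, h2]
        · simp [Config.setLoc, Config.setChan, h1]
      · intro μ' he
        injection he with h1 h2
        exact h ⟨h1.symm, h2.symm⟩
  | invoke | ret | scdDeliver | noDeliver | crash | idle =>
    exact .inl ⟨by simp [Config.setLoc], by simp, by simp⟩

end Run

theorem Caller.next_ne_sending (k : Caller) (μ : Forward n M) (d : Finset (Fin n)) (k' : Caller) :
    (k.next : Control n M) ≠ .sending μ d k' := by
  cases k <;> simp [Caller.next]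

theorem candidates_subset (B : Finset (Quadruplet n M)) : candidates B ⊆ B := by
  classical
  exact Finset.filter_subset _ _

theorem PurgeStep.subset {B T T' : Finset (Quadruplet n M)} (h : PurgeStep B T T') : T' ⊆ T := by
  classical
  obtain ⟨q, -, q', -, -, rfl⟩ := h
  exact Finset.erase_subset _ _

theorem ToDeliver.subset_candidates {B T : Finset (Quadruplet n M)} (h : ToDeliver B T) :
    T ⊆ candidates B := by
  obtain ⟨h, -⟩ := h
  induction h with
  | refl => exact subset_rfl
  | tail _ hs ih => exact hs.subset.trans ih

theorem ToDeliver.subset {B T : Finset (Quadruplet n M)} (h : ToDeliver B T) : T ⊆ B :=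
  h.subset_candidates.trans (candidates_subset B)

/-! ### Numbering of the forwardings of one process -/

namespace Run

variable {ρ : Run n M}

/-- In the step at time `τ`, process `i` starts to fifo-broadcast `μ`. -/
def Start (ρ : Run n M) (τ : ℕ) (i : Fin n) (μ : Forward n M) : Prop :=
  ∃ μ₀ k, ρ.Call τ i μ₀ k ∧ μ = ⟨μ₀.m, μ₀.sd, μ₀.snsd, i, ρ.sn τ i⟩ ∧ ρ.ctl τ i = .ready ∧
    ρ.clk τ i μ.sd < (μ.snsd : WithBot ℕ) ∧ ¬ ρ.InBuf τ i μ.key ∧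
    ρ.ctl (τ + 1) i = .sending μ Finset.univ k ∧ ρ.sn (τ + 1) i = ρ.sn τ i ∧
    ρ.InBuf (τ + 1) i μ.key

theorem Fwd.mono {τ τ' : ℕ} {i : Fin n} {μ : Forward n M} (h : ρ.Fwd τ i μ) (hle : τ ≤ τ') :
    ρ.Fwd τ' i μ := by
  obtain ⟨t, ht, h⟩ := h
  exact ⟨t, ht.trans hle, h⟩

theorem Rcv.mono {τ τ' : ℕ} {i j : Fin n} {μ : Forward n M} (h : ρ.Rcv τ i j μ) (hle : τ ≤ τ') :
    ρ.Rcv τ' i j μ := by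
  obtain ⟨t, ht, h⟩ := h
  exact ⟨t, ht.trans_le hle, h⟩

theorem fwd_of_ctl {τ : ℕ} {i : Fin n} {μ : Forward n M} {d : Finset (Fin n)} {k : Caller}
    (h : ρ.ctl τ i = .sending μ d k) : ρ.Fwd τ i μ := ⟨τ, le_rfl, d, k, h⟩

theorem Start.fwd {τ : ℕ} {i : Fin n} {μ : Forward n M} (h : ρ.Start τ i μ) :
    ρ.Fwd (τ + 1) i μ := by
  obtain ⟨_, k, -, -, -, -, -, h, -⟩ := h
  exact fwd_of_ctl h

theorem ctl_zero (i : Fin n) : ρ.ctl 0 i = .ready := by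
  simp [ctl, ρ.start, initialConfig, initialLocal]

theorem buf_zero (i : Fin n) : ρ.buf 0 i = ∅ := by
  simp [buf, ρ.start, initialConfig, initialLocal]

theorem clk_zero (i j : Fin n) : ρ.clk 0 i j = ⊥ := by
  simp [clk, ρ.start, initialConfig, initialLocal]

theorem chan_zero (i j : Fin n) : ρ.chan 0 i j = [] := by
  simp [chan, ρ.start, initialConfig]

theorem not_fwd_zero (i : Fin n) (μ : Forward n M) : ¬ ρ.Fwd 0 i μ := by
  rintro ⟨t, ht, d, k, h⟩
  obtain rfl : t = 0 := by omega
  simp [ctl_zero] at h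

theorem not_rcv_zero (i j : Fin n) (μ : Forward n M) : ¬ ρ.Rcv 0 i j μ := by
  rintro ⟨t, ht, -⟩
  omega

/-- A process in the middle of a fifo-broadcast either just started it or was in the middle of
it already. -/
theorem sending_succ {τ : ℕ} {i : Fin n} {μ : Forward n M} {d : Finset (Fin n)} {k : Caller}
    (h : ρ.ctl (τ + 1) i = .sending μ d k) :
    (∃ d', ρ.ctl τ i = .sending μ d' k ∧ ρ.sn (τ + 1) i = ρ.sn τ i ∧
      ρ.buf (τ + 1) i = ρ.buf τ i ∧
      ((d' = d ∧ ∀ j ν, ρ.act τ ≠ .send i j ν) ∨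
        ∃ j ∈ d', ρ.act τ = .send i j μ ∧ d = d'.erase j ∧ d ≠ ∅)) ∨
    (d = Finset.univ ∧ ρ.Start τ i μ) := by
  cases ρ.localCase τ i with
  | quiet hb hs hc ho hk hr hd =>
    exact .inl ⟨d, hk ▸ h, hs, hb, .inl ⟨rfl, hd⟩⟩
  | ret m ha hb hs hc ho hk hq =>
    exact .inl ⟨d, hk ▸ h, hs, hb, .inl ⟨rfl, by simp [ha]⟩⟩
  | drop μ' k' ha hrd hle hb hs hc hk => exact absurd (hk.symm.trans h) (k'.next_ne_sending _ _ _)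
  | update μ' k' ha hrd hle hin hb hs hc hk =>
    exact absurd (hk.symm.trans h) (k'.next_ne_sending _ _ _)
  | start μ' k' ha hrd hlt hin hb hs hc hk =>
    have he := hk.symm.trans h
    injection he with h1 h2 h3
    subst h1 h2 h3
    refine .inr ⟨rfl, μ', k', ha, rfl, hrd, hlt, hin, hk, hs, _, (hb _).2 (.inl rfl), rfl⟩
  | send j μ' d' k' ha hk hj hb hc ho hk' =>
    rcases hk' with ⟨-, hk', -⟩ | ⟨hne, hk', hs⟩
    · exact absurd (hk'.symm.trans h) (k'.next_ne_sending _ _ _)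
    · have he := hk'.symm.trans h
      injection he with h1 h2 h3
      subst h1 h3
      refine .inl ⟨d', hk, hs, hb, .inr ⟨j, hj, ha, by rw [← h2], h2 ▸ hne⟩⟩
  | deliver T hT ha hk hk' hb hc hs ho => rw [hk'] at h; cases h

theorem fwd_succ {τ : ℕ} {i : Fin n} {μ : Forward n M} (h : ρ.Fwd (τ + 1) i μ) :
    ρ.Fwd τ i μ ∨ ρ.Start τ i μ := by
  obtain ⟨t, ht, d, k, h⟩ := h
  rcases Nat.le_succ_iff.1 ht with ht | rfl
  · exact .inl ⟨t, ht, d, k, h⟩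
  · rcases sending_succ h with ⟨d', h', -⟩ | ⟨-, h'⟩
    · exact .inl (fwd_of_ctl h')
    · exact .inr h'

theorem rcv_succ {τ : ℕ} {i j : Fin n} {μ : Forward n M} (h : ρ.Rcv (τ + 1) i j μ) :
    ρ.Rcv τ i j μ ∨ (ρ.act τ = .receive i j ∧ ∃ l, ρ.chan τ i j = μ :: l) := by
  obtain ⟨t, ht, h⟩ := h
  rcases Nat.lt_succ_iff_lt_or_eq.1 ht with ht | rfl
  · exact .inl ⟨t, ht, h⟩
  · exact .inr h

theorem sn_le_succ (τ : ℕ) (i : Fin n) : ρ.sn τ i ≤ ρ.sn (τ + 1) i := by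
  cases ρ.localCase τ i <;> omega

theorem sn_mono {τ τ' : ℕ} (i : Fin n) (h : τ ≤ τ') : ρ.sn τ i ≤ ρ.sn τ' i :=
  monotone_nat_of_le_succ (f := fun τ => ρ.sn τ i) (fun τ => sn_le_succ τ i) h

theorem clk_le_succ (τ : ℕ) (i j : Fin n) : ρ.clk τ i j ≤ ρ.clk (τ + 1) i j := by
  cases ρ.localCase τ i with
  | deliver T hT ha hk hk' hb hc hs ho => rw [hc]; exact le_sup_left
  | _ => simp_all

theorem clk_mono {τ τ' : ℕ} (i j : Fin n) (h : τ ≤ τ') : ρ.clk τ i j ≤ ρ.clk τ' i j :=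
  monotone_nat_of_le_succ (f := fun τ => ρ.clk τ i j) (fun τ => clk_le_succ τ i j) h

theorem sending_inv {τ : ℕ} {i : Fin n} {μ : Forward n M} {d : Finset (Fin n)} {k : Caller}
    (h : ρ.ctl τ i = .sending μ d k) :
    μ.f = i ∧ μ.snf = ρ.sn τ i ∧ d.Nonempty ∧ ρ.InBuf τ i μ.key := by
  induction τ generalizing d with
  | zero => simp [ctl_zero] at h
  | succ τ ih =>
    rcases sending_succ h with ⟨d', h', hs, hb, hd⟩ | ⟨rfl, μ₀, k', -, rfl, -, -, -, -, hs, hin⟩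
    · obtain ⟨h1, h2, h3, h4⟩ := ih h'
      refine ⟨h1, by rw [hs, h2], ?_, ?_⟩
      · rcases hd with ⟨rfl, -⟩ | ⟨j, -, -, -, hne⟩
        · exact h3
        · exact Finset.nonempty_iff_ne_empty.2 hne
      · simpa only [InBuf, hb] using h4
    · exact ⟨rfl, hs.symm, ⟨i, Finset.mem_univ i⟩, hin⟩

/-- Only the last send of a fifo-broadcast increments `sn`, so the forwarding in progress has number
`sn` and the completed ones have smaller numbers. A process that crashes in the middle stays in the
second case. -/
theorem fwd_inv {τ : ℕ} {i : Fin n} {μ : Forward n M} (h : ρ.Fwd τ i μ) :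
    μ.f = i ∧ (μ.snf < ρ.sn τ i ∨ ∃ d k, ρ.ctl τ i = .sending μ d k) := by
  induction τ with
  | zero => exact absurd h (not_fwd_zero _ _)
  | succ τ ih =>
    rcases fwd_succ h with h | ⟨_, k, -, rfl, -, -, -, hk, -⟩
    · obtain ⟨h1, h2⟩ := ih h
      refine ⟨h1, ?_⟩
      rcases h2 with h2 | ⟨d, k, hk⟩
      · exact .inl (h2.trans_le (sn_le_succ τ i))
      · have hsn := (sending_inv hk).2.1
        cases ρ.localCase τ i with
        | quiet hb hs hc ho hk' hr hd => exact .inr ⟨d, k, hk'.trans hk⟩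
        | ret m ha hb hs hc ho hk' hq => exact .inr ⟨d, k, hk'.trans hk⟩
        | send j μ' d' k' ha hk₁ hj hb hc ho hk' =>
          rw [hk] at hk₁
          injection hk₁ with h3 h4 h5
          subst h3 h4 h5
          rcases hk' with ⟨-, -, hs⟩ | ⟨-, hk', -⟩
          · exact .inl (by omega)
          · exact .inr ⟨_, _, hk'⟩
        | _ => simp_all
    · exact ⟨rfl, .inr ⟨_, _, hk⟩⟩

theorem Fwd.snf_le {τ : ℕ} {i : Fin n} {μ : Forward n M} (h : ρ.Fwd τ i μ) :
    μ.snf ≤ ρ.sn τ i := by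
  rcases (fwd_inv h).2 with h | ⟨d, k, h⟩
  · exact h.le
  · exact (sending_inv h).2.1.le

theorem Fwd.snf_lt {τ : ℕ} {i : Fin n} {μ : Forward n M} (h : ρ.Fwd τ i μ)
    (hk : ρ.ctl τ i = .ready) : μ.snf < ρ.sn τ i := by
  rcases (fwd_inv h).2 with h | ⟨d, k, h⟩
  · exact h
  · rw [hk] at h; cases h

theorem Start.snf {τ : ℕ} {i : Fin n} {μ : Forward n M} (h : ρ.Start τ i μ) :
    μ.snf = ρ.sn τ i := by
  obtain ⟨_, _, -, rfl, -⟩ := h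
  rfl

theorem Start.ready {τ : ℕ} {i : Fin n} {μ : Forward n M} (h : ρ.Start τ i μ) :
    ρ.ctl τ i = .ready := by
  obtain ⟨_, _, -, -, h, -⟩ := h
  exact h

theorem Start.unique {τ : ℕ} {i : Fin n} {μ ν : Forward n M} (h : ρ.Start τ i μ)
    (h' : ρ.Start τ i ν) : μ = ν := by
  obtain ⟨_, k, -, -, -, -, -, h, -⟩ := h
  obtain ⟨_, k', -, -, -, -, -, h', -⟩ := h'
  rw [h] at h'
  injection h'

/-- A forwarding starts only at control point `ready`, where all previous ones have numbers below
`sn`, the number of the new one. -/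
theorem Fwd.eq_of_snf {τ : ℕ} {i : Fin n} {μ ν : Forward n M} (h : ρ.Fwd τ i μ)
    (h' : ρ.Fwd τ i ν) (he : μ.snf = ν.snf) : μ = ν := by
  induction τ with
  | zero => exact absurd h (not_fwd_zero _ _)
  | succ τ ih =>
    rcases fwd_succ h with h | h <;> rcases fwd_succ h' with h' | h'
    · exact ih h h'
    · have := h.snf_lt h'.ready
      have := h'.snf
      omega
    · have := h'.snf_lt h.ready
      have := h.snf
      omega
    · exact h.unique h'

/-- A message forwarded later has a greater sequence number. -/
theorem Fwd.of_snf_lt {τ τ' : ℕ} {i : Fin n} {ν : Forward n M} (h : ρ.Fwd τ' i ν)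
    (hlt : ν.snf < ρ.sn τ i) : ρ.Fwd τ i ν := by
  rcases le_total τ' τ with hle | hle
  · exact h.mono hle
  · induction τ', hle using Nat.le_induction with
    | base => exact h
    | succ t ht ih =>
      rcases fwd_succ h with h | h
      · exact ih h
      · have := h.snf
        have := sn_mono (ρ := ρ) i ht
        omega

/-! ### Buffers and clocks: no message is forwarded twice -/

theorem InBuf.succ {τ : ℕ} {i : Fin n} {x : Fin n × ℕ} (h : ρ.InBuf τ i x) :
    ρ.InBuf (τ + 1) i x ∨ ∃ T, ToDeliver (ρ.buf τ i) T ∧ T ≠ ∅ ∧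
      ρ.act τ = .scdDeliver i (messages T) ∧ (∃ q ∈ T, q.key = x) ∧
      (∀ q, q ∈ ρ.buf (τ + 1) i ↔ q ∈ ρ.buf τ i ∧ q ∉ T) ∧
      (x.2 : WithBot ℕ) ≤ ρ.clk (τ + 1) i x.1 := by
  classical
  obtain ⟨q, hq, rfl⟩ := h
  cases ρ.localCase τ i with
  | quiet hb => exact .inl ⟨q, hb ▸ hq, rfl⟩
  | ret m ha hb => exact .inl ⟨q, hb ▸ hq, rfl⟩
  | drop μ k ha hrd hle hb => exact .inl ⟨q, hb ▸ hq, rfl⟩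
  | update μ k ha hrd hlt hin hb =>
    refine .inl ⟨_, (hb _).2 ⟨q, hq, rfl⟩, ?_⟩
    split_ifs <;> rfl
  | start μ k ha hrd hlt hin hb => exact .inl ⟨q, (hb _).2 (.inr hq), rfl⟩
  | send j μ d k ha hk hj hb => exact .inl ⟨q, hb ▸ hq, rfl⟩
  | deliver T hT ha hk hk' hb hc =>
    by_cases hqT : q ∈ T
    · rcases ha with ⟨ha, hne⟩ | ⟨-, rfl⟩
      · refine .inr ⟨T, hT, hne, ha, ⟨q, hqT, rfl⟩, hb, ?_⟩
        rw [hc]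
        refine le_sup_of_le_right
          (Finset.le_sup (f := fun q : Quadruplet n M => (q.sn : WithBot ℕ)) ?_)
        exact Finset.mem_filter.2 ⟨hqT, rfl⟩
      · simp at hqT
    · exact .inl ⟨q, (hb _).2 ⟨hq, hqT⟩, rfl⟩

theorem buf_succ {τ : ℕ} {i : Fin n} {q' : Quadruplet n M} (h : q' ∈ ρ.buf (τ + 1) i) :
    (∃ q ∈ ρ.buf τ i, q.key = q'.key ∧ q.m = q'.m) ∨
    ∃ μ, ρ.Start τ i μ ∧ μ.key = q'.key ∧ μ.m = q'.m := by
  cases ρ.localCase τ i with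
  | quiet hb => exact .inl ⟨q', hb ▸ h, rfl, rfl⟩
  | ret m ha hb => exact .inl ⟨q', hb ▸ h, rfl, rfl⟩
  | drop μ k ha hrd hle hb => exact .inl ⟨q', hb ▸ h, rfl, rfl⟩
  | update μ k ha hrd hlt hin hb =>
    obtain ⟨q, hq, rfl⟩ := (hb _).1 h
    refine .inl ⟨q, hq, ?_⟩
    split_ifs <;> exact ⟨rfl, rfl⟩
  | start μ k ha hrd hlt hin hb hs hc hk =>
    rcases (hb _).1 h with rfl | hq
    · exact .inr ⟨_, ⟨μ, k, ha, rfl, hrd, hlt, hin, hk, hs, _, h, rfl⟩, rfl, rfl⟩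
    · exact .inl ⟨q', hq, rfl, rfl⟩
  | send j μ d k ha hk hj hb => exact .inl ⟨q', hb ▸ h, rfl, rfl⟩
  | deliver T hT ha hk hk' hb => exact .inl ⟨q', ((hb _).1 h).1, rfl, rfl⟩

theorem fwd_of_mem_buf {τ : ℕ} {i : Fin n} {q : Quadruplet n M} (h : q ∈ ρ.buf τ i) :
    ∃ μ, ρ.Fwd τ i μ ∧ μ.key = q.key ∧ μ.m = q.m := by
  induction τ generalizing q with
  | zero => simp [buf_zero] at h
  | succ τ ih =>
    rcases buf_succ h with ⟨q', hq', h1, h2⟩ | ⟨μ, hμ, h1, h2⟩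
    · obtain ⟨μ, hμ, h3, h4⟩ := ih hq'
      exact ⟨μ, hμ.mono (Nat.le_succ _), h3.trans h1, h4.trans h2⟩
    · exact ⟨μ, hμ.fwd, h1, h2⟩

/-- A quadruplet leaves the buffer only by a delivery, which lifts the clock to its number. This is
what keeps `forward` from accepting the message again. -/
theorem Fwd.inBuf_or_le {τ : ℕ} {i : Fin n} {μ : Forward n M} (h : ρ.Fwd τ i μ) :
    ρ.InBuf τ i μ.key ∨ (μ.snsd : WithBot ℕ) ≤ ρ.clk τ i μ.sd := by
  induction τ with
  | zero => exact absurd h (not_fwd_zero _ _)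
  | succ τ ih =>
    rcases fwd_succ h with h | ⟨_, k, -, rfl, -, -, -, -, -, hin⟩
    · rcases ih h with h | h
      · rcases h.succ with h | ⟨T, -, -, -, -, -, h⟩
        · exact .inl h
        · exact .inr h
      · exact .inr (h.trans (clk_le_succ _ _ _))
    · exact .inl hin

theorem Fwd.eq_of_key {τ : ℕ} {i : Fin n} {μ ν : Forward n M} (h : ρ.Fwd τ i μ)
    (h' : ρ.Fwd τ i ν) (he : μ.key = ν.key) : μ = ν := by
  have aux : ∀ {τ μ ν}, ρ.Fwd τ i μ → ρ.Start τ i ν → μ.key = ν.key → False := by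
    rintro τ μ ν h ⟨_, _, -, -, -, hlt, hin, -⟩ he
    rcases h.inBuf_or_le with h | h
    · exact hin (he ▸ h)
    · simp only [Forward.key, Prod.mk.injEq] at he
      rw [he.1, he.2] at h
      exact absurd hlt (not_lt.2 h)
  induction τ with
  | zero => exact absurd h (not_fwd_zero _ _)
  | succ τ ih =>
    rcases fwd_succ h with h | h <;> rcases fwd_succ h' with h' | h'
    · exact ih h h'
    · exact (aux h h' he).elim
    · exact (aux h' h he.symm).elim
    · exact h.unique h'

theorem eq_of_mem_buf {τ : ℕ} {i : Fin n} {q q' : Quadruplet n M} (h : q ∈ ρ.buf τ i)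
    (h' : q' ∈ ρ.buf τ i) (he : q.key = q'.key) : q = q' := by
  classical
  induction τ generalizing q q' with
  | zero => simp [buf_zero] at h
  | succ τ ih =>
    cases ρ.localCase τ i with
    | quiet hb => rw [hb] at h h'; exact ih h h' he
    | ret m ha hb => rw [hb] at h h'; exact ih h h' he
    | drop μ k ha hrd hle hb => rw [hb] at h h'; exact ih h h' he
    | update μ k ha hrd hlt hin hb =>
      obtain ⟨p, hp, rfl⟩ := (hb _).1 h
      obtain ⟨p', hp', rfl⟩ := (hb _).1 h'
      have : p.key = p'.key := by
        split_ifs at he <;> exact he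
      rw [ih hp hp' this]
    | start μ k ha hrd hlt hin hb hs hc hk =>
      rcases (hb _).1 h with rfl | h <;> rcases (hb _).1 h' with rfl | h'
      · rfl
      · exact absurd ⟨_, h', he.symm⟩ hin
      · exact absurd ⟨_, h, he⟩ hin
      · exact ih h h' he
    | send j μ d k ha hk hj hb => rw [hb] at h h'; exact ih h h' he
    | deliver T hT ha hk hk' hb => exact ih ((hb _).1 h).1 ((hb _).1 h').1 he

/-- Provides a witness when the clock test rejects a message: some message of the same sender, with
at least its number, has been forwarded. -/
theorem clk_attained {τ : ℕ} {i j : Fin n} {a : ℕ} (h : ρ.clk τ i j = (a : WithBot ℕ)) :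
    ∃ μ, ρ.Fwd τ i μ ∧ μ.key = (j, a) := by
  induction τ with
  | zero => simp [clk_zero] at h
  | succ τ ih =>
    have old : ρ.clk τ i j = (a : WithBot ℕ) → ∃ μ, ρ.Fwd (τ + 1) i μ ∧ μ.key = (j, a) := by
      intro h
      obtain ⟨μ, h1, h2⟩ := ih h
      exact ⟨μ, h1.mono (Nat.le_succ _), h2⟩
    cases ρ.localCase τ i with
    | deliver T hT ha hk hk' hb hc hs ho =>
      rw [hc] at h
      rcases le_total (ρ.clk τ i j)
        ((T.filter fun q => q.sd = j).sup fun q => (q.sn : WithBot ℕ)) with hle | hle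
      · rw [sup_eq_right.2 hle] at h
        have hne : (T.filter fun q => q.sd = j).Nonempty := by
          rw [Finset.nonempty_iff_ne_empty]
          intro he
          rw [he] at h
          simp at h
        obtain ⟨q, hq, hqe⟩ := Finset.exists_mem_eq_sup _ hne
          (fun q : Quadruplet n M => (q.sn : WithBot ℕ))
        rw [hqe] at h
        obtain ⟨hqT, hqj⟩ := Finset.mem_filter.1 hq
        obtain ⟨μ, h1, h2, -⟩ := fwd_of_mem_buf (hT.subset hqT)
        refine ⟨μ, h1.mono (Nat.le_succ _), h2.trans ?_⟩
        simp only [Quadruplet.key, hqj, Prod.mk.injEq, true_and]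
        exact_mod_cast h
      · exact old (by rwa [sup_eq_left.2 hle] at h)
    | quiet hb hs hc => exact old (by rwa [hc] at h)
    | ret m ha hb hs hc => exact old (by rwa [hc] at h)
    | drop μ k ha hrd hle hb hs hc => exact old (by rwa [hc] at h)
    | update μ k ha hrd hlt hin hb hs hc => exact old (by rwa [hc] at h)
    | start μ k ha hrd hlt hin hb hs hc => exact old (by rwa [hc] at h)
    | send j μ d k ha hk hj hb hc => exact old (by rwa [hc] at h)

/-! ### FIFO channels -/

theorem send_inv {τ : ℕ} {i j : Fin n} {μ : Forward n M} (h : ρ.act τ = .send i j μ) :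
    ∃ d k, ρ.ctl τ i = .sending μ d k ∧ j ∈ d := by
  have hst := ρ.step τ
  rw [h] at hst
  generalize ρ.state (τ + 1) = c' at hst
  cases hst with
  | send _ _ _ d k hcr hctl hj => exact ⟨d, k, hctl, hj⟩

/-- `μ` has been sent on the channel from `i` to `j`. -/
def Sent (ρ : Run n M) (τ : ℕ) (i j : Fin n) (μ : Forward n M) : Prop :=
  μ ∈ ρ.chan τ i j ∨ ρ.Rcv τ i j μ

theorem sent_succ {τ : ℕ} {i j : Fin n} {μ : Forward n M} (h : ρ.Sent (τ + 1) i j μ) :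
    ρ.Sent τ i j μ ∨ ρ.act τ = .send i j μ := by
  rcases h with h | h
  · rcases ρ.chan_succ τ i j with ⟨hc, -⟩ | ⟨ν, -, hc⟩ | ⟨ν, ha, hc⟩
    · exact .inl (.inl (hc ▸ h))
    · exact .inl (.inl (hc ▸ List.mem_cons_of_mem _ h))
    · rw [hc, List.mem_append, List.mem_singleton] at h
      rcases h with h | rfl
      · exact .inl (.inl h)
      · exact .inr ha
  · rcases rcv_succ h with h | ⟨-, l, hc⟩
    · exact .inl (.inr h)
    · exact .inl (.inl (hc ▸ List.mem_cons_self))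

theorem Sent.succ {τ : ℕ} {i j : Fin n} {μ : Forward n M} (h : ρ.Sent τ i j μ) :
    ρ.Sent (τ + 1) i j μ := by
  rcases h with h | h
  · rcases ρ.chan_succ τ i j with ⟨hc, -⟩ | ⟨ν, ha, hc⟩ | ⟨ν, ha, hc⟩
    · exact .inl (hc ▸ h)
    · rw [hc, List.mem_cons] at h
      rcases h with rfl | h
      · exact .inr ⟨τ, Nat.lt_succ_self _, ha, _, hc⟩
      · exact .inl h
    · exact .inl (hc ▸ List.mem_append_left _ h)
  · exact .inr (h.mono (Nat.le_succ _))

theorem sent_of_act {τ : ℕ} {i j : Fin n} {μ : Forward n M} (h : ρ.act τ = .send i j μ) :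
    ρ.Sent (τ + 1) i j μ := by
  rcases ρ.chan_succ τ i j with ⟨-, -, h'⟩ | ⟨ν, ha, -⟩ | ⟨ν, ha, hc⟩
  · exact absurd h (h' μ)
  · simp [h] at ha
  · rw [h] at ha
    injection ha with _ _ ha
    exact .inl (by rw [hc, ha]; simp)

theorem Sent.fwd {τ : ℕ} {i j : Fin n} {μ : Forward n M} (h : ρ.Sent τ i j μ) :
    ρ.Fwd τ i μ := by
  induction τ with
  | zero =>
    rcases h with h | h
    · simp [chan_zero] at h
    · exact absurd h (not_rcv_zero _ _ _)
  | succ τ ih =>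
    rcases sent_succ h with h | h
    · exact (ih h).mono (Nat.le_succ _)
    · obtain ⟨d, k, hk, -⟩ := send_inv h
      exact (fwd_of_ctl hk).mono (Nat.le_succ _)

/-- The messages sent to `j` before the current fifo-broadcast reaches `j` are older. -/
theorem Sent.lt_of_pending {τ : ℕ} {i j : Fin n} {μ ν : Forward n M} {d : Finset (Fin n)}
    {k : Caller} (h : ρ.Sent τ i j ν) (hk : ρ.ctl τ i = .sending μ d k) (hj : j ∈ d) :
    ν.snf < ρ.sn τ i := by
  induction τ generalizing d with
  | zero => simp [ctl_zero] at hk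
  | succ τ ih =>
    rcases sending_succ hk with ⟨d', hk', hs, -, hd⟩ | ⟨-, hst⟩
    · rw [hs]
      rcases sent_succ h with h | h
      · refine ih h hk' ?_
        rcases hd with ⟨rfl, -⟩ | ⟨j', -, -, rfl, -⟩
        · exact hj
        · exact Finset.mem_of_mem_erase hj
      · rcases hd with ⟨-, hd⟩ | ⟨j', -, ha, rfl, -⟩
        · exact absurd h (hd _ _)
        · rw [ha] at h
          injection h with _ h
          exact absurd h.symm (Finset.ne_of_mem_erase hj)
    · have := hst.ready
      rcases sent_succ h with h | h
      · exact (h.fwd.snf_lt this).trans_le (sn_le_succ _ _)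
      · obtain ⟨_, _, h, -⟩ := send_inv h
        rw [this] at h
        cases h

theorem sorted_chan (τ : ℕ) (i j : Fin n) :
    (ρ.chan τ i j).Pairwise (fun μ ν => μ.snf < ν.snf) := by
  induction τ with
  | zero => simp [chan_zero]
  | succ τ ih =>
    rcases ρ.chan_succ τ i j with ⟨hc, -⟩ | ⟨ν, ha, hc⟩ | ⟨ν, ha, hc⟩
    · rwa [hc]
    · rw [hc] at ih
      exact (List.pairwise_cons.1 ih).2
    · rw [hc, List.pairwise_append]
      refine ⟨ih, List.pairwise_singleton _ _, ?_⟩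
      intro μ hμ ν' hν'
      rw [List.mem_singleton] at hν'
      subst hν'
      obtain ⟨d, k, hk, hj⟩ := send_inv ha
      rw [(sending_inv hk).2.1]
      exact Sent.lt_of_pending (.inl hμ) hk hj

theorem Rcv.lt_of_mem_chan {τ : ℕ} {i j : Fin n} {μ ν : Forward n M} (h : ρ.Rcv τ i j μ)
    (hν : ν ∈ ρ.chan τ i j) : μ.snf < ν.snf := by
  induction τ with
  | zero => exact absurd h (not_rcv_zero _ _ _)
  | succ τ ih =>
    rcases ρ.chan_succ τ i j with ⟨hc, ha, -⟩ | ⟨ν', ha, hc⟩ | ⟨ν', ha, hc⟩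
    · rcases rcv_succ h with h | ⟨h, -⟩
      · exact ih h (hc ▸ hν)
      · exact absurd h ha
    · rcases rcv_succ h with h | ⟨-, l, hl⟩
      · exact ih h (hc ▸ List.mem_cons_of_mem _ hν)
      · have hs := ρ.sorted_chan τ i j
        rw [hc] at hs hl
        injection hl with hl
        exact hl ▸ (List.pairwise_cons.1 hs).1 _ hν
    · rcases rcv_succ h with h | ⟨h, -⟩
      · rw [hc, List.mem_append, List.mem_singleton] at hν
        rcases hν with hν | rfl
        · exact ih h hν
        · obtain ⟨d, k, hk, hj⟩ := send_inv ha
          rw [(sending_inv hk).2.1]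
          exact Sent.lt_of_pending (.inr h) hk hj
      · simp [h] at ha

theorem Fwd.sent_or_pending {τ : ℕ} {i : Fin n} {μ : Forward n M} (h : ρ.Fwd τ i μ)
    (j : Fin n) : ρ.Sent τ i j μ ∨ ∃ d k, ρ.ctl τ i = .sending μ d k ∧ j ∈ d := by
  classical
  induction τ with
  | zero => exact absurd h (not_fwd_zero _ _)
  | succ τ ih =>
    rcases fwd_succ h with h | ⟨_, k, -, -, -, -, -, hk, -⟩
    · rcases ih h with h | ⟨d, k, hk, hj⟩
      · exact .inl h.succ
      · cases ρ.localCase τ i with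
        | quiet hb hs hc ho hk' hr hd => exact .inr ⟨d, k, hk'.trans hk, hj⟩
        | ret m ha hb hs hc ho hk' hq => exact .inr ⟨d, k, hk'.trans hk, hj⟩
        | send j' μ' d' k' ha hk₁ hj' hb hc ho hk' =>
          rw [hk] at hk₁
          injection hk₁ with h3 h4 h5
          subst h3 h4 h5
          by_cases hjj : j = j'
          · subst hjj
            exact .inl (sent_of_act ha)
          · have hj₁ : j ∈ d.erase j' := Finset.mem_erase.2 ⟨hjj, hj⟩
            rcases hk' with ⟨he, -⟩ | ⟨-, hk', -⟩
            · refine absurd hj₁ ?_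
              simp_all
            · exact .inr ⟨_, _, hk', by convert hj₁⟩
        | _ => simp_all
    · exact .inr ⟨_, _, hk, Finset.mem_univ j⟩

/-- The channels are FIFO: what was forwarded by `i` before a message received by `j` from `i` has
been received by `j`. -/
theorem Rcv.fifo {τ : ℕ} {i j : Fin n} {μ ν : Forward n M} (h : ρ.Rcv τ i j ν)
    (hμ : ρ.Fwd τ i μ) (hlt : μ.snf < ν.snf) : ρ.Rcv τ i j μ := by
  have hν : ν.snf ≤ ρ.sn τ i := (Sent.fwd (.inr h)).snf_le
  rcases hμ.sent_or_pending j with (hc | hr) | ⟨d, k, hk, -⟩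
  · have := h.lt_of_mem_chan hc
    omega
  · exact hr
  · have := (sending_inv hk).2.1
    omega

/-! ### Senders, invocations and causality -/

/-- The first forwarding of an application message is the one by its sender. -/
def _root_.SCD.Forward.origin (μ : Forward n M) : Forward n M := ⟨μ.m, μ.sd, μ.snsd, μ.sd, μ.snsd⟩

theorem Fwd.origin {τ : ℕ} {i : Fin n} {μ : Forward n M} (h : ρ.Fwd τ i μ) :
    ρ.Fwd τ μ.sd μ.origin := by
  induction τ generalizing i μ with
  | zero => exact absurd h (not_fwd_zero _ _)
  | succ τ ih =>
    rcases fwd_succ h with h | hst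
    · exact (ih h).mono (Nat.le_succ _)
    · obtain ⟨μ₀, k, hcall, rfl, -, -, -, hk, -⟩ := id hst
      rcases hcall with ⟨-, -, h1, h2, -⟩ | ⟨-, ⟨f, -, l, hc⟩, -⟩
      · have he : Forward.origin ⟨μ₀.m, μ₀.sd, μ₀.snsd, i, ρ.sn τ i⟩ =
            ⟨μ₀.m, μ₀.sd, μ₀.snsd, i, ρ.sn τ i⟩ := by
          simp [Forward.origin, h1, h2]
        rw [he]
        simp only
        rw [h1, ← h1]
        simpa [h1] using h
      · have hf : ρ.Fwd τ f μ₀ := Sent.fwd (.inl (by rw [hc]; simp))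
        exact (ih hf).mono (Nat.le_succ _)

theorem Fwd.invoked {τ : ℕ} {i : Fin n} {μ : Forward n M} (h : ρ.Fwd τ i μ) :
    ∃ τ' < τ, ρ.act τ' = .invoke μ.sd μ.m ∧ ρ.sn τ' μ.sd = μ.snsd := by
  induction τ generalizing i μ with
  | zero => exact absurd h (not_fwd_zero _ _)
  | succ τ ih =>
    have old : ∀ {i μ}, ρ.Fwd τ i μ →
        ∃ τ' < τ + 1, ρ.act τ' = .invoke μ.sd μ.m ∧ ρ.sn τ' μ.sd = μ.snsd := by
      intro i μ h
      obtain ⟨τ', h1, h2⟩ := ih h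
      exact ⟨τ', h1.trans (Nat.lt_succ_self _), h2⟩
    rcases fwd_succ h with h | hst
    · exact old h
    · obtain ⟨μ₀, k, hcall, rfl, -⟩ := hst
      rcases hcall with ⟨-, h0, h1, h2, -⟩ | ⟨-, ⟨f, -, l, hc⟩, -⟩
      · exact ⟨τ, Nat.lt_succ_self _, by simpa [h1] using h0, by simp [h1, h2]⟩
      · have hf : ρ.Fwd τ f μ₀ := Sent.fwd (.inl (by rw [hc]; simp))
        exact old (i := f) (μ := μ₀) hf

/-- A process numbers its own messages with the sequence numbers of its forwardings. -/
theorem Fwd.snf_eq {τ : ℕ} {i : Fin n} {μ : Forward n M} (h : ρ.Fwd τ i μ) (hi : μ.sd = i) :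
    μ.snf = μ.snsd := by
  subst hi
  rw [h.eq_of_key h.origin rfl]
  rfl

/-- Both forwardings go back to forwardings by the common sender, which uses a key only once. -/
theorem Fwd.of_key {τ τ' : ℕ} {i j : Fin n} {μ ν : Forward n M} (h : ρ.Fwd τ i μ)
    (h' : ρ.Fwd τ' j ν) (he : μ.key = ν.key) : μ.m = ν.m := by
  have h1 := h.origin.mono (le_max_left τ τ')
  have h2 := h'.origin.mono (le_max_right τ τ')
  simp only [Forward.key, Prod.mk.injEq] at he
  rw [he.1] at h1
  have := h1.eq_of_key h2 (by simp [Forward.origin, Forward.key, he])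
  change μ.origin.m = ν.origin.m
  rw [this]

/-- While it is outside scd-broadcast, a process has no message of its own in its buffer, and it
never has two. -/
theorem own_mem_buf {τ : ℕ} {i : Fin n} {q : Quadruplet n M} (hq : q ∈ ρ.buf τ i)
    (hi : q.sd = i) : ρ.op τ i ≠ none ∧ ∀ q' ∈ ρ.buf τ i, q'.sd = i → q'.key = q.key := by
  induction τ generalizing q with
  | zero => simp [buf_zero] at hq
  | succ τ ih =>
    have hold : ∀ q ∈ ρ.buf τ i, q.sd = i → ρ.op (τ + 1) i ≠ none := by
      intro q hq hi
      have h1 := (ih hq hi).1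
      have hcall : ∀ {μ k}, ρ.Call τ i μ k → ρ.op (τ + 1) i ≠ none := by
        rintro μ k (⟨-, -, -, -, -, -, -, h⟩ | ⟨-, -, h⟩)
        · simp [h]
        · rwa [h]
      cases ρ.localCase τ i with
      | quiet hb hs hc ho => rwa [ho]
      | ret m ha hb hs hc ho hk hq' => exact absurd hi (hq' q hq)
      | drop μ k ha => exact hcall ha
      | update μ k ha => exact hcall ha
      | start μ k ha => exact hcall ha
      | send j μ d k ha hk hj hb hc ho => rwa [ho]
      | deliver T hT ha hk hk' hb hc hs ho => rwa [ho]
    have hnew : ∀ μ, ρ.Start τ i μ → μ.sd = i →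
        ρ.op (τ + 1) i ≠ none ∧ ∀ q ∈ ρ.buf τ i, q.sd ≠ i := by
      rintro _ ⟨μ₀, k, hcall, rfl, -, hlt, hin, -⟩ hi
      rcases hcall with ⟨-, -, -, -, -, -, h1, h2⟩ | ⟨-, ⟨f, -, l, hc⟩, -⟩
      · exact ⟨by simp [h2], fun q hq hi => (ih hq hi).1 h1⟩
      · have hf : ρ.Fwd τ f μ₀ := Sent.fwd (.inl (by rw [hc]; simp))
        -- A message of `i` that comes back through a channel was already forwarded by `i`, so it is
        -- in the buffer or covered by the clock and cannot be added anew.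
        have ho := hf.origin
        simp only at hi hlt hin
        rw [hi] at ho
        rcases ho.inBuf_or_le with h | h
        · exact absurd h hin
        · simp only [Forward.origin] at h
          exact absurd hlt (not_lt.2 h)
    rcases buf_succ hq with ⟨p, hp, hpk, -⟩ | ⟨μ, hμ, hμk, -⟩
    · have hpi : p.sd = i := (congrArg Prod.fst hpk).trans hi
      refine ⟨hold p hp hpi, ?_⟩
      intro q' hq' hi'
      rcases buf_succ hq' with ⟨p', hp', hpk', -⟩ | ⟨μ', hμ', hμk', -⟩
      · rw [← hpk, ← hpk']
        exact (ih hp hpi).2 p' hp' ((congrArg Prod.fst hpk').trans hi')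
      · exact absurd hpi ((hnew μ' hμ' ((congrArg Prod.fst hμk').trans hi')).2 p hp)
    · obtain ⟨h1, h2⟩ := hnew μ hμ ((congrArg Prod.fst hμk).trans hi)
      refine ⟨h1, ?_⟩
      intro q' hq' hi'
      rcases buf_succ hq' with ⟨p', hp', hpk', -⟩ | ⟨μ', hμ', hμk', -⟩
      · exact absurd ((congrArg Prod.fst hpk').trans hi') (h2 p' hp')
      · rw [← hμk, ← hμk', hμ.unique hμ']

/-- An invocation of scd-broadcast starts a fifo-broadcast. -/
theorem Call.start_of_operation {τ : ℕ} {i : Fin n} {μ : Forward n M}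
    (h : ρ.Call τ i μ .operation) (hrd : ρ.ctl τ i = .ready) :
    ρ.clk τ i μ.sd < (μ.snsd : WithBot ℕ) ∧ ¬ ρ.InBuf τ i μ.key := by
  rcases h with ⟨-, -, h1, h2, -⟩ | ⟨h, -⟩
  · have key : ∀ ν, ρ.Fwd τ i ν → ν.sd = i → ν.snsd < ρ.sn τ i := by
      intro ν hν hi
      rw [← hν.snf_eq hi]
      exact hν.snf_lt hrd
    constructor
    · rw [h1, h2]
      cases hc : ρ.clk τ i i with
      | bot => exact WithBot.bot_lt_coe _
      | coe a =>
        obtain ⟨ν, hν, hk⟩ := clk_attained hc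
        simp only [Forward.key, Prod.mk.injEq] at hk
        have := key ν hν hk.1
        rw [hk.2] at this
        exact WithBot.coe_lt_coe.2 this
    · rintro ⟨q, hq, hk⟩
      obtain ⟨ν, hν, hk', -⟩ := fwd_of_mem_buf hq
      rw [hk] at hk'
      simp only [Forward.key, Prod.mk.injEq] at hk'
      have := key ν hν (hk'.1.trans h1)
      omega
  · cases h

theorem Call.eq_of_receive {τ : ℕ} {f i : Fin n} {μ ν : Forward n M} {k : Caller}
    {l : List (Forward n M)} (h : ρ.Call τ i ν k) (ha : ρ.act τ = .receive f i)
    (hc : ρ.chan τ f i = μ :: l) : k = .handler ∧ ν = μ := by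
  rcases h with ⟨-, h, -⟩ | ⟨hk, ⟨f', h, l', hc'⟩, -⟩
  · simp [ha] at h
  · rw [ha] at h
    injection h with h
    subst h
    rw [hc] at hc'
    injection hc' with h1
    exact ⟨hk, h1.symm⟩

/-- The two statements feed each other. If `i` forwards `ν` on receiving it from `f`, then `f`
forwarded `μ` before `ν`; by FIFO `i` received `μ` earlier, and by the second statement forwarded
it. Conversely, if the clock test drops a received message, the clock value comes from a message of
the same sender with at least its number, to which causality applies. Comparing `μ.snf` with
`ν.snsd` makes sense because a sender numbers its own messages with its forwarding counter. -/
theorem causal_and_fwd_of_rcv (τ : ℕ) :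
    (∀ i ν μ, ρ.Fwd τ i ν → ρ.Fwd τ ν.sd μ → μ.snf < ν.snsd →
      ∃ μ', ρ.Fwd τ i μ' ∧ μ'.key = μ.key ∧ μ'.snf < ν.snf) ∧
    ∀ f i μ, ρ.Rcv τ f i μ → ∃ ν, ρ.Fwd τ i ν ∧ ν.key = μ.key := by
  induction τ with
  | zero => exact ⟨fun i ν μ h => absurd h (not_fwd_zero _ _),
      fun f i μ h => absurd h (not_rcv_zero _ _ _)⟩
  | succ τ ih =>
    obtain ⟨ihC, ihR⟩ := ih
    constructor
    · intro i ν μ hν hμ hlt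
      rcases fwd_succ hν with hν | hst
      · have hμ : ρ.Fwd τ ν.sd μ := hμ.of_snf_lt (hlt.trans_le hν.origin.snf_le)
        obtain ⟨μ', h1, h2⟩ := ihC i ν μ hν hμ hlt
        exact ⟨μ', h1.mono (Nat.le_succ _), h2⟩
      · obtain ⟨ν₀, k, hcall, rfl, hrd, -⟩ := hst
        rcases hcall with ⟨-, h0, h1, h2, -⟩ | ⟨-, ⟨f, ha, l, hc⟩, -⟩
        · simp only at hμ hlt
          rw [h1] at hμ
          exact ⟨μ, hμ, rfl, by simp only; omega⟩
        · have hf : ρ.Fwd τ f ν₀ := Sent.fwd (.inl (by rw [hc]; simp))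
          simp only at hμ hlt
          have hμ : ρ.Fwd τ ν₀.sd μ := hμ.of_snf_lt (hlt.trans_le hf.origin.snf_le)
          obtain ⟨μ₁, h1, h2, h3⟩ := ihC f ν₀ μ hf hμ hlt
          have hr : ρ.Rcv (τ + 1) f i ν₀ := ⟨τ, Nat.lt_succ_self _, ha, l, hc⟩
          rcases rcv_succ (hr.fifo (h1.mono (Nat.le_succ _)) h3) with hr₁ | ⟨-, l', hc'⟩
          · obtain ⟨μ₂, h4, h5⟩ := ihR f i μ₁ hr₁
            exact ⟨μ₂, h4.mono (Nat.le_succ _), h5.trans h2, h4.snf_lt hrd⟩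
          · rw [hc] at hc'
            injection hc' with he
            subst he
            omega
    · intro f i μ h
      rcases rcv_succ h with h | ⟨ha, l, hc⟩
      · obtain ⟨ν, h1, h2⟩ := ihR f i μ h
        exact ⟨ν, h1.mono (Nat.le_succ _), h2⟩
      · have hf : ρ.Fwd τ f μ := Sent.fwd (.inl (by rw [hc]; simp))
        cases ρ.localCase τ i with
        | quiet hb hs hcl ho hk hr hd => exact absurd ha (hr f)
        | ret m ha' => simp [ha] at ha'
        | drop μ₀ k hcall hrd hle =>
          obtain ⟨-, rfl⟩ := hcall.eq_of_receive ha hc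
          cases hcl : ρ.clk τ i μ₀.sd with
          | bot => rw [hcl] at hle; simp at hle
          | coe a =>
            obtain ⟨ν, hν, hk⟩ := clk_attained hcl
            rw [hcl] at hle
            have hle : μ₀.snsd ≤ a := WithBot.coe_le_coe.1 hle
            rcases hle.eq_or_lt with he | hlt
            · exact ⟨ν, hν.mono (Nat.le_succ _), by rw [hk, ← he]; rfl⟩
            · simp only [Forward.key, Prod.mk.injEq] at hk
              obtain ⟨μ', h1, h2, -⟩ := ihC i ν μ₀.origin hν (by rw [hk.1]; exact hf.origin)
                (by rw [hk.2]; exact hlt)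
              exact ⟨μ', h1.mono (Nat.le_succ _), h2⟩
        | update μ₀ k hcall hrd hlt hin =>
          obtain ⟨-, rfl⟩ := hcall.eq_of_receive ha hc
          obtain ⟨q, hq, hqk⟩ := hin
          obtain ⟨ν, h1, h2, -⟩ := fwd_of_mem_buf hq
          exact ⟨ν, h1.mono (Nat.le_succ _), h2.trans hqk⟩
        | start μ₀ k hcall hrd hlt hin hb hs hcl hk =>
          obtain ⟨-, rfl⟩ := hcall.eq_of_receive ha hc
          exact ⟨_, fwd_of_ctl hk, rfl⟩
        | send j μ d k ha' => simp [ha] at ha'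
        | deliver T hT ha' => simp [ha] at ha'

/-- The processes that forward a message forward before it all that its sender had forwarded
before it. -/
theorem Fwd.causal {τ : ℕ} {i : Fin n} {μ ν : Forward n M} (hν : ρ.Fwd τ i ν)
    (hμ : ρ.Fwd τ ν.sd μ) (hlt : μ.snf < ν.snsd) :
    ∃ μ', ρ.Fwd τ i μ' ∧ μ'.key = μ.key ∧ μ'.snf < ν.snf :=
  (causal_and_fwd_of_rcv τ).1 i ν μ hν hμ hlt

theorem Rcv.fwd {τ : ℕ} {f i : Fin n} {μ : Forward n M} (h : ρ.Rcv τ f i μ) :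
    ∃ ν, ρ.Fwd τ i ν ∧ ν.key = μ.key :=
  (causal_and_fwd_of_rcv τ).2 f i μ h

/-! ### What the entries of `cl` record -/

/-- The exception `f = i` is needed: an invocation writes the sender's own entry before the message
comes back on the channel from the sender to itself. -/
theorem cl_inv {τ : ℕ} {i f : Fin n} {q : Quadruplet n M} (hq : q ∈ ρ.buf τ i)
    (hf : q.cl f ≠ ⊤) : ∃ μ, ρ.Fwd τ f μ ∧ μ.key = q.key ∧ q.cl f = (μ.snf : ℕ∞) ∧
      (ρ.Rcv τ f i μ ∨ f = i ∧ q.sd = i) := by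
  classical
  induction τ generalizing q with
  | zero => simp [buf_zero] at hq
  | succ τ ih =>
    have old : ∀ {q}, q ∈ ρ.buf τ i → q.cl f ≠ ⊤ → ∃ μ, ρ.Fwd (τ + 1) f μ ∧ μ.key = q.key ∧
        q.cl f = (μ.snf : ℕ∞) ∧ (ρ.Rcv (τ + 1) f i μ ∨ f = i ∧ q.sd = i) := by
      intro q hq hf
      obtain ⟨μ, h1, h2, h3, h4⟩ := ih hq hf
      exact ⟨μ, h1.mono (Nat.le_succ _), h2, h3, h4.imp_left fun h => h.mono (Nat.le_succ _)⟩
    have hcall : ∀ {μ}, ρ.Call τ i μ .handler →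
        ρ.Fwd (τ + 1) μ.f μ ∧ ρ.Rcv (τ + 1) μ.f i μ := by
      rintro μ (⟨h, -⟩ | ⟨-, ⟨f', ha, l, hc⟩, -⟩)
      · cases h
      · have hf : ρ.Fwd τ f' μ := Sent.fwd (.inl (by rw [hc]; simp))
        obtain rfl := (fwd_inv hf).1
        exact ⟨hf.mono (Nat.le_succ _), τ, Nat.lt_succ_self _, ha, l, hc⟩
    cases ρ.localCase τ i with
    | quiet hb => rw [hb] at hq; exact old hq hf
    | ret m ha hb => rw [hb] at hq; exact old hq hf
    | drop μ k ha hrd hle hb => rw [hb] at hq; exact old hq hf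
    | update μ k ha hrd hlt hin hb =>
      cases k with
      | operation => exact absurd hin (ha.start_of_operation hrd).2
      | handler =>
        obtain ⟨q₀, hq₀, rfl⟩ := (hb _).1 hq
        split_ifs at hf ⊢ with hk
        · by_cases hfe : f = μ.f
          · subst hfe
            exact ⟨μ, (hcall ha).1, hk.symm, by simp, .inl (hcall ha).2⟩
          · simp only [ne_eq, hfe, not_false_eq_true, Function.update_of_ne] at hf ⊢
            exact old hq₀ hf
        · exact old hq₀ hf
    | start μ k ha hrd hlt hin hb hs hc hk =>
      rcases (hb _).1 hq with rfl | hq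
      · by_cases hfe : f = μ.f
        · subst hfe
          cases k with
          | handler => exact ⟨μ, (hcall ha).1, rfl, by simp, .inl (hcall ha).2⟩
          | operation =>
            rcases ha with ⟨-, -, h1, h2, h3, h4, -⟩ | ⟨h, -⟩
            · rw [h3]
              exact ⟨_, fwd_of_ctl hk, rfl, by simp [h4], .inr ⟨rfl, h1⟩⟩
            · cases h
        · simp [hfe] at hf
      · exact old hq hf
    | send j μ d k ha hk hj hb => rw [hb] at hq; exact old hq hf
    | deliver T hT ha hk hk' hb => exact old ((hb _).1 hq).1 hf

-- The exit condition of the loop gives the majority; the point is that a strict inequality between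
-- entries reflects the true order at `f`. Had `f` forwarded `q` before a received `p`, FIFO would
-- make the entry of `q` known and smaller. Faithfulness of entries is a hypothesis, `hcl`, because
-- the lemma serves inside the induction that proves it.
open Classical in
theorem prec_of_purge {τ : ℕ} {i : Fin n} {T : Finset (Quadruplet n M)} {p q : Quadruplet n M}
    (hcl : ∀ f μ q, ρ.Rcv τ f i μ → q ∈ ρ.buf τ i → q.key = μ.key → q.cl f = (μ.snf : ℕ∞))
    (hT : ToDeliver (ρ.buf τ i) T) (hp : p ∈ T) (hq : q ∈ ρ.buf τ i) (hqT : q ∉ T) :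
    n < 2 * (Finset.univ.filter fun f => p.cl f < q.cl f).card ∧
    ∀ f, p.cl f < q.cl f → ∃ μ, ρ.Fwd τ f μ ∧ μ.key = p.key ∧
      ∀ ν, ρ.Fwd τ f ν → ν.key = q.key → μ.snf < ν.snf := by
  have hpB : p ∈ ρ.buf τ i := hT.subset hp
  have hcard : n < 2 * (Finset.univ.filter fun f => p.cl f < q.cl f).card := by
    by_contra hle
    exact hT.2 (T.erase p) ⟨p, hp, q, Finset.mem_sdiff.2 ⟨hq, hqT⟩, not_lt.1 hle, rfl⟩
  have hne : p.key ≠ q.key := fun he => hqT (eq_of_mem_buf hpB hq he ▸ hp)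
  refine ⟨hcard, fun f hf => ?_⟩
  obtain ⟨μ, hμ, hμk, hμc, hr⟩ := cl_inv hpB hf.ne_top
  refine ⟨μ, hμ, hμk, fun ν hν hνk => ?_⟩
  by_contra hle
  have hlt : ν.snf < μ.snf := by
    refine lt_of_le_of_ne (not_lt.1 hle) fun he => hne ?_
    rw [← hμk, ← hνk, hν.eq_of_snf hμ he]
  have key : ∀ g μ ν, ρ.Rcv τ g i μ → μ.key = p.key → ρ.Fwd τ g ν → ν.key = q.key →
      ν.snf < μ.snf → ¬ p.cl g < q.cl g := by
    intro g μ ν hμ hμk hν hνk hlt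
    rw [hcl g μ p hμ hpB hμk.symm, hcl g ν q (hμ.fifo hν hlt) hq hνk.symm, not_lt]
    exact_mod_cast hlt.le
  rcases hr with hr | ⟨rfl, hi⟩
  · exact key f μ ν hr hμk hν hνk hlt hf
  -- Here `p` is a message of `i` itself, perhaps not yet received back, so FIFO says nothing about
  -- the entry of `i`. Causality does: if `i` forwarded `q` before `p`, so did every other `g` that
  -- forwarded `p`, and only `i` can be left in the majority.
  · have hsub : (Finset.univ.filter fun g => p.cl g < q.cl g) ⊆ {f} := by
      intro g hg
      have hg := (Finset.mem_filter.1 hg).2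
      rw [Finset.mem_singleton]
      by_contra hgf
      obtain ⟨μg, h1, h2, h3, h4⟩ := cl_inv hpB hg.ne_top
      have h4 : ρ.Rcv τ g f μg := h4.resolve_right fun h => hgf h.1
      have hk2 := h2
      have hk1 := hμk
      simp only [Forward.key, Quadruplet.key, Prod.mk.injEq] at hk1 hk2
      have h5 := hμ.snf_eq (hk1.1.trans hi)
      obtain ⟨ν', h6, h7, h8⟩ := h1.causal (μ := ν) (by rw [hk2.1, hi]; exact hν) (by omega)
      exact key g μg ν' h4 h2 h6 (h7.trans hνk) h8 hg
    have h1 := Finset.card_le_card hsub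
    rw [Finset.card_singleton] at h1
    -- A strict majority inside a singleton forces `n = 1`. Then `q` is also a message of `i`, which
    -- never has two of its own in its buffer.
    have hqi : q.sd = f := Fin.ext (by omega)
    exact hne ((own_mem_buf hq hqi).2 p hpB hi)

/-- At a delivery, faithful entries allow the use of `prec_of_purge`, and since all processes
forward the messages of one sender in order, no older message of that sender is left behind.
Conversely, an entry could be lost only if the clock rejected a message still in the buffer, which
the first part excludes, or if the message was received before entering the buffer, which `Rcv.fwd`
excludes. -/
theorem clk_lt_and_cl_of_rcv (τ : ℕ) (i : Fin n) :
    (∀ q ∈ ρ.buf τ i, ρ.clk τ i q.sd < (q.sn : WithBot ℕ)) ∧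
    ∀ f μ q, ρ.Rcv τ f i μ → q ∈ ρ.buf τ i → q.key = μ.key → q.cl f = (μ.snf : ℕ∞) := by
  classical
  induction τ with
  | zero => simp [buf_zero]
  | succ τ ih =>
    obtain ⟨ih1, ih2⟩ := ih
    constructor
    · intro q hq
      cases ρ.localCase τ i with
      | quiet hb hs hc => rw [hb] at hq; rw [hc]; exact ih1 q hq
      | ret m ha hb hs hc => rw [hb] at hq; rw [hc]; exact ih1 q hq
      | drop μ k ha hrd hle hb hs hc => rw [hb] at hq; rw [hc]; exact ih1 q hq
      | update μ k ha hrd hlt hin hb hs hc =>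
        obtain ⟨q₀, hq₀, rfl⟩ := (hb _).1 hq
        rw [hc]
        split_ifs <;> exact ih1 q₀ hq₀
      | start μ k ha hrd hlt hin hb hs hc =>
        rw [hc]
        rcases (hb _).1 hq with rfl | hq
        · exact hlt
        · exact ih1 q hq
      | send j μ d k ha hk hj hb hc => rw [hb] at hq; rw [hc]; exact ih1 q hq
      | deliver T hT ha hk hk' hb hc =>
        obtain ⟨hq, hqT⟩ := (hb q).1 hq
        rw [hc]
        refine max_lt (ih1 q hq) ((Finset.sup_lt_iff (WithBot.bot_lt_coe _)).2 fun p hp => ?_)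
        obtain ⟨hpT, hpq⟩ := Finset.mem_filter.1 hp
        obtain ⟨h1, h2⟩ := prec_of_purge ih2 hT hpT hq hqT
        have hpos : 0 < (Finset.univ.filter fun f => p.cl f < q.cl f).card := by omega
        obtain ⟨f, hf⟩ := Finset.card_pos.1 hpos
        obtain ⟨μ, hμ, hμk, h3⟩ := h2 f (Finset.mem_filter.1 hf).2
        obtain ⟨ν, hν, hνk, -⟩ := fwd_of_mem_buf hq
        by_contra hlt
        have hle : q.sn ≤ p.sn := WithBot.coe_le_coe.1 (not_lt.1 hlt)
        rcases hle.eq_or_lt with he | hlt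
        · have hpq' : p = q := eq_of_mem_buf (hT.subset hpT) hq
            (by simp [Quadruplet.key, hpq, he])
          exact hqT (hpq' ▸ hpT)
        · have hμk' := hμk
          have hνk' := hνk
          simp only [Forward.key, Quadruplet.key, Prod.mk.injEq] at hμk' hνk'
          -- Here `p` would be a later message of the sender of `q`, so `f` would have forwarded `q`
          -- before `p`.
          obtain ⟨μ', h4, h5, h6⟩ := hμ.causal (μ := ν.origin)
            (by rw [hμk'.1, hpq, ← hνk'.1]; exact hν.origin)
            (by simp only [Forward.origin]; omega)
          have := h3 μ' h4 (h5.trans hνk)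
          omega
    · intro f μ q hr hq hqk
      rcases rcv_succ hr with hr | ⟨ha, l, hc⟩
      · cases ρ.localCase τ i with
        | quiet hb => rw [hb] at hq; exact ih2 f μ q hr hq hqk
        | ret m ha hb => rw [hb] at hq; exact ih2 f μ q hr hq hqk
        | drop μ₀ k ha hrd hle hb => rw [hb] at hq; exact ih2 f μ q hr hq hqk
        | update μ₀ k ha hrd hlt hin hb =>
          obtain ⟨q₀, hq₀, rfl⟩ := (hb _).1 hq
          split_ifs at hqk ⊢ with hk
          · by_cases hfe : f = μ₀.f
            · subst hfe
              cases k with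
              | operation => exact absurd hin (ha.start_of_operation hrd).2
              | handler =>
                rcases ha with ⟨h, -⟩ | ⟨-, ⟨f', ha, l, hc⟩, -⟩
                · cases h
                · have hf : ρ.Fwd τ f' μ₀ := Sent.fwd (.inl (by rw [hc]; simp))
                  have hfe := (fwd_inv hf).1
                  rw [← hfe] at hf
                  have hμ : ρ.Fwd τ μ₀.f μ := Sent.fwd (.inr hr)
                  rw [hμ.eq_of_key hf (hqk.symm.trans hk)]
                  simp
            · simp only [ne_eq, hfe, not_false_eq_true, Function.update_of_ne]
              exact ih2 f μ q₀ hr hq₀ hqk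
          · exact ih2 f μ q₀ hr hq₀ hqk
        | start μ₀ k ha hrd hlt hin hb =>
          rcases (hb _).1 hq with rfl | hq
          · obtain ⟨ν, hν, hνk⟩ := hr.fwd
            have hk := hνk.trans hqk.symm
            rcases hν.inBuf_or_le with h | h
            · rw [hk] at h
              exact absurd h hin
            · simp only [Forward.key, Quadruplet.key, Prod.mk.injEq] at hk
              rw [hk.1, hk.2] at h
              exact absurd hlt (not_lt.2 h)
          · exact ih2 f μ q hr hq hqk
        | send j μ₀ d k ha hk hj hb => rw [hb] at hq; exact ih2 f μ q hr hq hqk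
        | deliver T hT ha hk hk' hb => exact ih2 f μ q hr ((hb _).1 hq).1 hqk
      · have hf : ρ.Fwd τ f μ := Sent.fwd (.inl (by rw [hc]; simp))
        have hfe := (fwd_inv hf).1
        cases ρ.localCase τ i with
        | quiet hb hs hcl ho hk hr hd => exact absurd ha (hr f)
        | ret m ha' => simp [ha] at ha'
        | drop μ₀ k hcall hrd hle hb =>
          obtain ⟨-, rfl⟩ := hcall.eq_of_receive ha hc
          rw [hb] at hq
          have := ih1 q hq
          simp only [Forward.key, Quadruplet.key, Prod.mk.injEq] at hqk
          rw [hqk.1, hqk.2] at this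
          exact absurd this (not_lt.2 hle)
        | update μ₀ k hcall hrd hlt hin hb =>
          obtain ⟨-, rfl⟩ := hcall.eq_of_receive ha hc
          obtain ⟨q₀, hq₀, rfl⟩ := (hb _).1 hq
          split_ifs at hqk ⊢ with hk
          · simp [hfe]
          · exact absurd hqk hk
        | start μ₀ k hcall hrd hlt hin hb hs hcl hk =>
          obtain ⟨-, rfl⟩ := hcall.eq_of_receive ha hc
          rcases (hb _).1 hq with rfl | hq
          · simp [hfe]
          · exact absurd ⟨q, hq, hqk⟩ hin
        | send j μ d k ha' => simp [ha] at ha'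
        | deliver T hT ha' => simp [ha] at ha'

theorem clk_lt_of_mem_buf {τ : ℕ} {i : Fin n} {q : Quadruplet n M} (hq : q ∈ ρ.buf τ i) :
    ρ.clk τ i q.sd < (q.sn : WithBot ℕ) :=
  (clk_lt_and_cl_of_rcv τ i).1 q hq

theorem Rcv.cl_eq {τ : ℕ} {i f : Fin n} {μ : Forward n M} {q : Quadruplet n M}
    (h : ρ.Rcv τ f i μ) (hq : q ∈ ρ.buf τ i) (hk : q.key = μ.key) : q.cl f = (μ.snf : ℕ∞) :=
  (clk_lt_and_cl_of_rcv τ i).2 f μ q h hq hk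

/-! ### Deliveries and majority precedence -/

/-- `f` forwards `x`, and does not forward `y` before `x`. -/
def Prec (ρ : Run n M) (f : Fin n) (x y : Fin n × ℕ) : Prop :=
  ∃ τ μ, ρ.Fwd τ f μ ∧ μ.key = x ∧ ∀ τ' ν, ρ.Fwd τ' f ν → ν.key = y → μ.snf < ν.snf

theorem Prec.asymm {f : Fin n} {x y : Fin n × ℕ} (h : ρ.Prec f x y) : ¬ ρ.Prec f y x := by
  rintro ⟨τ', ν, hν, hy, h2⟩
  obtain ⟨τ, μ, hμ, hx, h1⟩ := h
  exact lt_asymm (h1 τ' ν hν hy) (h2 τ μ hμ hx)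

/-- Whatever `f` starts to forward after time `τ` gets a greater number than `μ`, so the comparison
at time `τ` is final. -/
theorem prec_of_fwd {τ : ℕ} {f : Fin n} {μ : Forward n M} {y : Fin n × ℕ} (hμ : ρ.Fwd τ f μ)
    (h : ∀ ν, ρ.Fwd τ f ν → ν.key = y → μ.snf < ν.snf) : ρ.Prec f μ.key y := by
  refine ⟨τ, μ, hμ, rfl, fun τ' ν hν hy => ?_⟩
  by_contra hle
  have hle := not_lt.1 hle
  refine hle.not_gt (h ν ?_ hy)
  rcases (hle.trans hμ.snf_le).lt_or_eq with hlt | he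
  · exact hν.of_snf_lt hlt
  · have := hμ.snf_le
    rwa [(hν.mono (le_max_right τ τ')).eq_of_snf (hμ.mono (le_max_left τ τ')) (by omega)]

/-- By time `τ`, process `i` has withdrawn the message `x` from its buffer. -/
def Done (ρ : Run n M) (τ : ℕ) (i : Fin n) (x : Fin n × ℕ) : Prop :=
  ¬ ρ.InBuf τ i x ∧ ∃ μ, ρ.Fwd τ i μ ∧ μ.key = x

theorem Done.mono {τ τ' : ℕ} {i : Fin n} {x : Fin n × ℕ} (h : ρ.Done τ i x) (hle : τ ≤ τ') :
    ρ.Done τ' i x := by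
  obtain ⟨hin, μ, hμ, rfl⟩ := h
  refine ⟨?_, μ, hμ.mono hle, rfl⟩
  rintro ⟨q, hq, hk⟩
  have h1 := (hμ.inBuf_or_le.resolve_left hin).trans (clk_mono i μ.sd hle)
  have h2 := clk_lt_of_mem_buf hq
  simp only [Forward.key, Quadruplet.key, Prod.mk.injEq] at hk
  rw [hk.1, hk.2] at h2
  exact absurd h2 (not_lt.2 h1)

open Classical in
/-- If `i` delivers `x` while `y` is not delivered yet, then a majority of the processes forward
`x` before `y`. -/
theorem majority_prec {τ : ℕ} {i : Fin n} {T : Finset (Quadruplet n M)} {p : Quadruplet n M}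
    {y : Fin n × ℕ} (hT : ToDeliver (ρ.buf τ i) T)
    (hb : ∀ q, q ∈ ρ.buf (τ + 1) i ↔ q ∈ ρ.buf τ i ∧ q ∉ T) (hp : p ∈ T)
    (hy : ¬ ρ.Done (τ + 1) i y) :
    n < 2 * (Finset.univ.filter fun f => ρ.Prec f p.key y).card := by
  have hpB : p ∈ ρ.buf τ i := hT.subset hp
  by_cases hin : ρ.InBuf τ i y
  · obtain ⟨q, hq, rfl⟩ := hin
    obtain ⟨ν, hν, hνk, -⟩ := fwd_of_mem_buf hq
    have hin : ρ.InBuf (τ + 1) i q.key := by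
      by_contra hin
      exact hy ⟨hin, ν, hν.mono (Nat.le_succ _), hνk⟩
    obtain ⟨q', hq', hk⟩ := hin
    obtain ⟨hqB, hqT⟩ := (hb q').1 hq'
    obtain ⟨h1, h2⟩ := prec_of_purge (clk_lt_and_cl_of_rcv τ i).2 hT hp hqB hqT
    refine h1.trans_le (Nat.mul_le_mul_left 2 (Finset.card_le_card ?_))
    intro f hf
    obtain ⟨μ, h3, h4, h5⟩ := h2 f (Finset.mem_filter.1 hf).2
    rw [Finset.mem_filter, ← h4, ← hk]
    exact ⟨Finset.mem_univ _, prec_of_fwd h3 h5⟩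
  -- Now `i` has never forwarded `y`. By FIFO and `Rcv.fwd`, no process with a finite entry for `p`
  -- forwarded `y` first, so the majority required by `candidates` is the one sought.
  · have hny : ∀ ν, ρ.Fwd τ i ν → ν.key ≠ y := by
      intro ν hν hk
      refine hy ⟨?_, ν, hν.mono (Nat.le_succ _), hk⟩
      rintro ⟨q, hq, hqk⟩
      exact hin ⟨q, ((hb q).1 hq).1, hqk⟩
    have hc := (Finset.mem_filter.1 (hT.subset_candidates hp)).2
    refine hc.trans_le (Nat.mul_le_mul_left 2 (Finset.card_le_card ?_))
    intro f hf
    obtain ⟨μ, h1, h2, h3, h4⟩ := cl_inv hpB (Finset.mem_filter.1 hf).2.ne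
    rw [Finset.mem_filter, ← h2]
    refine ⟨Finset.mem_univ _, prec_of_fwd h1 fun ν hν hk => ?_⟩
    by_contra hle
    rcases h4 with h4 | ⟨rfl, -⟩
    · rcases (not_lt.1 hle).eq_or_lt with he | hlt
      · obtain ⟨ν', h5, h6⟩ := h4.fwd
        refine hny ν' h5 ?_
        rw [h6, ← hν.eq_of_snf h1 he, hk]
      · obtain ⟨ν', h5, h6⟩ := (h4.fifo hν hlt).fwd
        exact hny ν' h5 (h6.trans hk)
    · exact hny ν hν hk

/-- At time `τ`, process `i` withdraws `x` from its buffer and scd-delivers it. -/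
def Deliv (ρ : Run n M) (τ : ℕ) (i : Fin n) (x : Fin n × ℕ) : Prop :=
  ∃ T, ToDeliver (ρ.buf τ i) T ∧ (∀ q, q ∈ ρ.buf (τ + 1) i ↔ q ∈ ρ.buf τ i ∧ q ∉ T) ∧
    ρ.act τ = .scdDeliver i (messages T) ∧ ∃ q ∈ T, q.key = x

theorem Deliv.inBuf {τ : ℕ} {i : Fin n} {x : Fin n × ℕ} (h : ρ.Deliv τ i x) : ρ.InBuf τ i x := by
  obtain ⟨T, hT, -, -, q, hq, hk⟩ := h
  exact ⟨q, hT.subset hq, hk⟩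

theorem Deliv.done {τ : ℕ} {i : Fin n} {x : Fin n × ℕ} (h : ρ.Deliv τ i x) :
    ρ.Done (τ + 1) i x := by
  obtain ⟨T, hT, hb, -, q, hq, rfl⟩ := h
  obtain ⟨μ, hμ, hk, -⟩ := fwd_of_mem_buf (hT.subset hq)
  refine ⟨?_, μ, hμ.mono (Nat.le_succ _), hk⟩
  rintro ⟨q', hq', hk'⟩
  obtain ⟨h1, h2⟩ := (hb q').1 hq'
  exact h2 (eq_of_mem_buf h1 (hT.subset hq) hk' ▸ hq)

theorem Done.exists_deliv {τ : ℕ} {i : Fin n} {x : Fin n × ℕ} (h : ρ.Done τ i x) :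
    ∃ τ' < τ, ρ.Deliv τ' i x := by
  induction τ with
  | zero =>
    obtain ⟨-, μ, hμ, -⟩ := h
    exact absurd hμ (not_fwd_zero _ _)
  | succ τ ih =>
    by_cases hd : ρ.Done τ i x
    · obtain ⟨τ', h1, h2⟩ := ih hd
      exact ⟨τ', h1.trans (Nat.lt_succ_self _), h2⟩
    · obtain ⟨hin, μ, hμ, rfl⟩ := h
      rcases fwd_succ hμ with hμ | ⟨_, _, -, -, -, -, -, -, -, h⟩
      · have hin' : ρ.InBuf τ i μ.key := by
          by_contra hin'
          exact hd ⟨hin', μ, hμ, rfl⟩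
        rcases hin'.succ with h | ⟨T, hT, -, ha, hq, hb, -⟩
        · exact absurd h hin
        · exact ⟨τ, Nat.lt_succ_self _, T, hT, hb, ha, hq⟩
      · exact absurd h hin

open Classical in
theorem Deliv.majority {τ : ℕ} {i : Fin n} {x y : Fin n × ℕ} (h : ρ.Deliv τ i x)
    (hy : ¬ ρ.Done (τ + 1) i y) :
    n < 2 * (Finset.univ.filter fun f => ρ.Prec f x y).card := by
  obtain ⟨T, hT, hb, -, q, hq, rfl⟩ := h
  exact majority_prec hT hb hq hy

theorem exists_of_majorities {P Q : Fin n → Prop} [DecidablePred P] [DecidablePred Q]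
    (hP : n < 2 * (Finset.univ.filter P).card) (hQ : n < 2 * (Finset.univ.filter Q).card) :
    ∃ f, P f ∧ Q f := by
  by_contra h
  have hd : Disjoint (Finset.univ.filter P) (Finset.univ.filter Q) := by
    rw [Finset.disjoint_filter]
    exact fun f _ h1 h2 => h ⟨f, h1, h2⟩
  have h1 := Finset.card_union_of_disjoint hd
  have h2 := Finset.card_le_univ (Finset.univ.filter P ∪ Finset.univ.filter Q)
  rw [Fintype.card_fin] at h2
  omega

/-! ### Liveness -/

/-- At time `τ`, process `i` executes `try_deliver`. -/
def TryAct (ρ : Run n M) (τ : ℕ) (i : Fin n) : Prop :=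
  ρ.act τ = .noDeliver i ∨ ∃ ms, ρ.act τ = .scdDeliver i ms

theorem scdDeliver_inv {τ : ℕ} {i : Fin n} {ms : Finset M} (h : ρ.act τ = .scdDeliver i ms) :
    ∃ T, ToDeliver (ρ.buf τ i) T ∧ (∀ q, q ∈ ρ.buf (τ + 1) i ↔ q ∈ ρ.buf τ i ∧ q ∉ T) ∧
      T ≠ ∅ ∧ ms = messages T := by
  have hst := ρ.step τ
  rw [h] at hst
  generalize hc' : ρ.state (τ + 1) = c' at hst
  cases hst with
  | scdDeliver _ T hcr hctl hT hne =>
    exact ⟨T, hT, by simp [buf, hc', Config.setLoc, afterTryDeliver], hne, rfl⟩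

theorem TryAct.inv {τ : ℕ} {i : Fin n} (h : ρ.TryAct τ i) :
    ∃ T, ToDeliver (ρ.buf τ i) T ∧ ∀ q, q ∈ ρ.buf (τ + 1) i ↔ q ∈ ρ.buf τ i ∧ q ∉ T := by
  rcases h with h | ⟨ms, h⟩
  · have hst := ρ.step τ
    rw [h] at hst
    generalize hc' : ρ.state (τ + 1) = c' at hst
    cases hst with
    | noDeliver _ hcr hctl hT => exact ⟨∅, hT, by simp [buf, hc', Config.setLoc]⟩
  · obtain ⟨T, h1, h2, -⟩ := scdDeliver_inv h
    exact ⟨T, h1, h2⟩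

theorem invoke_inv {τ : ℕ} {i : Fin n} {m : M} (h : ρ.act τ = .invoke i m) :
    ρ.ctl τ i = .ready ∧ ρ.op τ i = none ∧ ρ.op (τ + 1) i = some m := by
  have hst := ρ.step τ
  rw [h] at hst
  generalize hc' : ρ.state (τ + 1) = c' at hst
  cases hst with
  | invoke _ _ hcr hctl hop =>
    refine ⟨hctl, hop, ?_⟩
    simp only [op, hc', Config.setLoc, Function.update_self, forward]
    split_ifs <;> rfl

theorem fwd_of_invoke {τ : ℕ} {i : Fin n} {m : M} (h : ρ.act τ = .invoke i m) :
    ρ.Fwd (τ + 1) i ⟨m, i, ρ.sn τ i, i, ρ.sn τ i⟩ := by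
  obtain ⟨hrd, ho, ho'⟩ := invoke_inv h
  have hcall : ∀ {μ k}, ρ.Call τ i μ k →
      k = .operation ∧ μ.m = m ∧ μ.sd = i ∧ μ.snsd = ρ.sn τ i := by
    rintro μ k (⟨h1, h2, h3, h4, -⟩ | ⟨-, ⟨f, h2, -⟩, -⟩)
    · rw [h] at h2
      injection h2 with h5 h6
      exact ⟨h1, h6.symm, h3, h4⟩
    · simp [h] at h2
  cases ρ.localCase τ i with
  | quiet hb hs hc ho'' => rw [ho'', ho] at ho'; cases ho'
  | ret m ha => simp [h] at ha
  | drop μ k ha hrd hle =>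
    obtain ⟨rfl, -⟩ := hcall ha
    exact absurd (ha.start_of_operation hrd).1 (not_lt.2 hle)
  | update μ k ha hrd hlt hin =>
    obtain ⟨rfl, -⟩ := hcall ha
    exact absurd hin (ha.start_of_operation hrd).2
  | start μ k ha hrd hlt hin hb hs hc hk =>
    obtain ⟨-, h1, h2, h3⟩ := hcall ha
    rw [h1, h2, h3] at hk
    exact fwd_of_ctl hk
  | send j μ d k ha => simp [h] at ha
  | deliver T hT ha => simp [h] at ha

/-- Induction on the number of messages ahead of `μ`: fairness forces a reception, which removes one
of them, and new messages join at the end. -/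
theorem exists_rcv_of_mem_chan (hfair : ρ.IsFair) {i j : Fin n} (hj : j ∉ ρ.faulty)
    {μ : Forward n M} {τ : ℕ} (hμ : μ ∈ ρ.chan τ i j) : ∃ τ', ρ.Rcv τ' i j μ := by
  obtain ⟨l₁, l₂, h⟩ := List.append_of_mem hμ
  clear hμ
  generalize hk : l₁.length = k
  replace hk := hk.le
  induction k generalizing τ l₁ l₂ with
  | zero =>
    obtain rfl : l₁ = [] := List.eq_nil_of_length_eq_zero (Nat.le_zero.1 hk)
    obtain ⟨τ', hle, ha⟩ := hfair.receive τ i j hj (by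
      show ρ.chan τ i j ≠ []
      simp [h])
    have hp : ∀ t ≥ τ, ρ.Rcv t i j μ ∨ ∃ l, ρ.chan t i j = μ :: l := by
      intro t ht
      induction t, ht using Nat.le_induction with
      | base => exact .inr ⟨l₂, h⟩
      | succ t ht ih =>
        rcases ih with ih | ⟨l, hl⟩
        · exact .inl (ih.mono (Nat.le_succ _))
        · rcases ρ.chan_succ t i j with ⟨hc, -⟩ | ⟨ν, ha, hc⟩ | ⟨ν, ha, hc⟩
          · exact .inr ⟨l, hc.trans hl⟩
          · exact .inl ⟨t, Nat.lt_succ_self _, ha, l, hl⟩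
          · exact .inr ⟨l ++ [ν], by rw [hc, hl]; rfl⟩
    rcases hp τ' hle with h | ⟨l, hl⟩
    · exact ⟨τ', h⟩
    · exact ⟨τ' + 1, τ', Nat.lt_succ_self _, ha, l, hl⟩
  | succ k ih =>
    by_contra hno
    obtain ⟨τ', hle, ha⟩ := hfair.receive τ i j hj (by
      show ρ.chan τ i j ≠ []
      simp [h])
    have hp : ∀ t ≥ τ, ∃ l₁ l₂, ρ.chan t i j = l₁ ++ μ :: l₂ ∧ l₁.length ≤ k + 1 := by
      intro t ht
      induction t, ht using Nat.le_induction with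
      | base => exact ⟨l₁, l₂, h, hk⟩
      | succ t ht ih =>
        obtain ⟨l₁, l₂, hl, hlen⟩ := ih
        rcases ρ.chan_succ t i j with ⟨hc, -⟩ | ⟨ν, ha, hc⟩ | ⟨ν, ha, hc⟩
        · exact ⟨l₁, l₂, hc.trans hl, hlen⟩
        · rw [hl] at hc
          cases l₁ with
          | nil => exact absurd ⟨t + 1, t, Nat.lt_succ_self _, ha, l₂, hl⟩ hno
          | cons a l₁ =>
            rw [List.cons_append] at hc
            injection hc with h1 h2
            exact ⟨l₁, l₂, h2.symm, by simp at hlen; omega⟩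
        · exact ⟨l₁, l₂ ++ [ν], by rw [hc, hl]; simp, hlen⟩
    obtain ⟨l₁, l₂, hl, hlen⟩ := hp τ' hle
    rcases ρ.chan_succ τ' i j with ⟨-, h', -⟩ | ⟨ν, -, hc⟩ | ⟨ν, ha', -⟩
    · exact h' ha
    · rw [hl] at hc
      cases l₁ with
      | nil => exact hno ⟨τ' + 1, τ', Nat.lt_succ_self _, ha, l₂, hl⟩
      | cons a l₁ =>
        rw [List.cons_append] at hc
        injection hc with h1 h2
        exact hno (ih l₁ l₂ h2.symm (by simp at hlen; omega))
    · simp [ha] at ha'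

/-- What a non-faulty process forwards is received by all non-faulty processes. -/
theorem Fwd.exists_rcv (hfair : ρ.IsFair) {i j : Fin n} (hi : i ∉ ρ.faulty) (hj : j ∉ ρ.faulty)
    {μ : Forward n M} {τ : ℕ} (h : ρ.Fwd τ i μ) : ∃ τ', ρ.Rcv τ' i j μ := by
  have hsent : ∀ {τ}, ρ.Sent τ i j μ → ∃ τ', ρ.Rcv τ' i j μ := by
    rintro τ (h | h)
    · exact exists_rcv_of_mem_chan hfair hj h
    · exact ⟨τ, h⟩
  rcases h.sent_or_pending j with h | ⟨d, k, hk, hjd⟩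
  · exact hsent h
  · obtain ⟨τ', -, ha⟩ := hfair.send τ i μ d k hi hk j hjd
    exact hsent (sent_of_act ha)

theorem exists_fwd (hfair : ρ.IsFair) {i j : Fin n} (hi : i ∉ ρ.faulty) (hj : j ∉ ρ.faulty)
    {μ : Forward n M} {τ : ℕ} (h : ρ.Fwd τ i μ) : ∃ τ' ν, ρ.Fwd τ' j ν ∧ ν.key = μ.key := by
  obtain ⟨τ', hr⟩ := h.exists_rcv hfair hi hj
  obtain ⟨ν, h1, h2⟩ := hr.fwd
  exact ⟨τ', ν, h1, h2⟩

/-- A non-faulty process finishes its fifo-broadcasts. -/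
theorem exists_next (hfair : ρ.IsFair) {i : Fin n} (hi : i ∉ ρ.faulty) {μ : Forward n M}
    {d : Finset (Fin n)} {k : Caller} {τ : ℕ} (h : ρ.ctl τ i = .sending μ d k) :
    ∃ τ' ≥ τ, ρ.ctl τ' i = k.next := by
  classical
  generalize hN : d.card = N
  induction N using Nat.strong_induction_on generalizing τ d with
  | _ N ih =>
    obtain ⟨j, hj⟩ := (sending_inv h).2.2.1
    obtain ⟨τ', hle, ha⟩ := hfair.send τ i μ d k hi h j hj
    by_contra hno
    have hp : ∀ t ≥ τ, ∃ d' ⊆ d, ρ.ctl t i = .sending μ d' k := by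
      intro t ht
      induction t, ht using Nat.le_induction with
      | base => exact ⟨d, subset_rfl, h⟩
      | succ t ht ih =>
        obtain ⟨d', hd', hk⟩ := ih
        cases ρ.localCase t i with
        | quiet hb hs hc ho hk' => exact ⟨d', hd', hk'.trans hk⟩
        | ret m ha hb hs hc ho hk' => exact ⟨d', hd', hk'.trans hk⟩
        | send j μ' d' k' ha hk₁ hj hb hc ho hk' =>
          rw [hk] at hk₁
          injection hk₁ with h3 h4 h5
          subst h3 h4 h5
          rcases hk' with ⟨-, hk', -⟩ | ⟨-, hk', -⟩
          · exact absurd ⟨t + 1, by omega, hk'⟩ hno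
          · refine ⟨_, ?_, hk'⟩
            intro x hx
            exact hd' (Finset.mem_of_mem_erase hx)
        | _ => simp_all
    obtain ⟨d', hd', hk⟩ := hp τ' hle
    cases ρ.localCase τ' i with
    | send j' μ' d'' k' ha' hk₁ hj' hb hc ho hk' =>
      rw [hk] at hk₁
      injection hk₁ with h3 h4 h5
      subst h3 h4 h5
      rcases hk' with ⟨-, hk', -⟩ | ⟨-, hk', -⟩
      · exact hno ⟨τ' + 1, by omega, hk'⟩
      · have hlt := (Finset.card_erase_lt_of_mem hj').trans_le (Finset.card_le_card hd')
        obtain ⟨t, h1, h2⟩ := ih _ (by rw [← hN]; convert hlt) hk' rfl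
        exact hno ⟨t, by omega, h2⟩
    | quiet hb hs hc ho hk' hr hd => exact hd _ _ ha
    | _ => simp_all

theorem exists_tryAct (hfair : ρ.IsFair) {i f : Fin n} (hi : i ∉ ρ.faulty) {τ : ℕ}
    (h : ρ.act τ = .receive f i) : ∃ τ' > τ, ρ.TryAct τ' i := by
  have key : ∀ {t}, t > τ → ρ.ctl t i = .delivering → ∃ τ' > τ, ρ.TryAct τ' i := by
    intro t ht hk
    obtain ⟨τ', h1, h2⟩ := hfair.deliver t i hi hk
    exact ⟨τ', by omega, h2⟩
  have hcall : ∀ {μ k}, ρ.Call τ i μ k → k = .handler := by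
    rintro μ k (⟨-, h2, -⟩ | ⟨h1, -⟩)
    · simp [h] at h2
    · exact h1
  cases ρ.localCase τ i with
  | quiet hb hs hc ho hk hr => exact absurd h (hr f)
  | ret m ha => simp [h] at ha
  | drop μ k ha hrd hle hb hs hc hk =>
    obtain rfl := hcall ha
    exact key (Nat.lt_succ_self _) hk
  | update μ k ha hrd hlt hin hb hs hc hk =>
    obtain rfl := hcall ha
    exact key (Nat.lt_succ_self _) hk
  | start μ k ha hrd hlt hin hb hs hc hk =>
    obtain rfl := hcall ha
    obtain ⟨t, h1, h2⟩ := exists_next hfair hi hk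
    exact key (by omega) h2
  | send j μ d k ha => simp [h] at ha
  | deliver T hT ha => simp [h] at ha

/-- There is an execution of `try_deliver` after which nothing is received or delivered until
time `L`. -/
theorem exists_tryAct_quiet (hfair : ρ.IsFair) {i f : Fin n} (hi : i ∉ ρ.faulty) {τ₀ L : ℕ}
    (h : ρ.act τ₀ = .receive f i) (hL : τ₀ < L) :
    ∃ τ, ρ.TryAct τ i ∧ ∀ e, τ < e → e < L →
      (∀ f, ρ.act e ≠ .receive f i) ∧ ¬ ρ.TryAct e i := by
  classical
  -- If the last event in `S` is a reception, the `try_deliver` that follows it lies at `L` or later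
  -- and the condition is vacuous; otherwise that last event is the `try_deliver` sought.
  let S := (Finset.range L).filter fun e => (∃ f, ρ.act e = .receive f i) ∨ ρ.TryAct e i
  have hS : S.Nonempty := ⟨τ₀, Finset.mem_filter.2 ⟨Finset.mem_range.2 hL, .inl ⟨f, h⟩⟩⟩
  have hmax : ∀ e, S.max' hS < e → e < L → (∀ f, ρ.act e ≠ .receive f i) ∧ ¬ ρ.TryAct e i := by
    intro e h1 h2
    have hne : e ∉ S := fun he => (S.le_max' e he).not_gt h1
    have hne : ¬ ((∃ f, ρ.act e = .receive f i) ∨ ρ.TryAct e i) :=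
      fun h => hne (Finset.mem_filter.2 ⟨Finset.mem_range.2 h2, h⟩)
    exact ⟨fun f h => hne (.inl ⟨f, h⟩), fun h => hne (.inr h)⟩
  rcases (Finset.mem_filter.1 (S.max'_mem hS)).2 with ⟨f, h⟩ | h
  · obtain ⟨τ, h1, h2⟩ := exists_tryAct hfair hi h
    exact ⟨τ, h2, fun e h3 h4 => hmax e (by omega) h4⟩
  · exact ⟨_, h, hmax⟩

/-! ### Finiteness of sets of messages -/

theorem finite_fwd (f : Fin n) (N : ℕ) :
    {x | ∃ τ ν, ρ.Fwd τ f ν ∧ ν.key = x ∧ ν.snf ≤ N}.Finite := by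
  have h : {ν | (∃ τ, ρ.Fwd τ f ν) ∧ ν.snf ≤ N}.Finite := by
    refine Set.Finite.of_finite_image (f := fun ν : Forward n M => ν.snf)
      ((Set.finite_Iic N).subset ?_) ?_
    · rintro _ ⟨ν, ⟨-, h⟩, rfl⟩
      exact h
    · rintro μ ⟨⟨τ, hμ⟩, -⟩ ν ⟨⟨τ', hν⟩, -⟩ he
      exact (hμ.mono (le_max_left τ τ')).eq_of_snf (hν.mono (le_max_right τ τ')) he
  refine (h.image Forward.key).subset ?_
  rintro _ ⟨τ, ν, h1, rfl, h2⟩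
  exact ⟨ν, ⟨⟨τ, h1⟩, h2⟩, rfl⟩

/-- The messages which some non-faulty process does not forward after `x`. -/
def Rivals (ρ : Run n M) (x : Fin n × ℕ) : Set (Fin n × ℕ) := {z | ∃ f ∉ ρ.faulty, ¬ ρ.Prec f x z}

theorem fwd_of_not_prec {f : Fin n} {μ : Forward n M} {τ : ℕ} {z : Fin n × ℕ}
    (hμ : ρ.Fwd τ f μ) (h : ¬ ρ.Prec f μ.key z) :
    ∃ τ' ν, ρ.Fwd τ' f ν ∧ ν.key = z ∧ ν.snf ≤ μ.snf := by
  by_contra hno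
  refine h ⟨τ, μ, hμ, rfl, fun τ' ν hν hk => ?_⟩
  by_contra hle
  exact hno ⟨τ', ν, hν, hk, not_lt.1 hle⟩

/-- Each non-faulty `f` forwards `x`, and only what it forwards no later than `x` can violate `Prec
f x`. -/
theorem finite_rivals {x : Fin n × ℕ}
    (h : ∀ f ∉ ρ.faulty, ∃ τ μ, ρ.Fwd τ f μ ∧ μ.key = x) : (ρ.Rivals x).Finite := by
  have hf : ∀ f, {z | f ∉ ρ.faulty ∧ ¬ ρ.Prec f x z}.Finite := by
    intro f
    by_cases hf : f ∈ ρ.faulty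
    · simp [hf]
    · obtain ⟨τ, μ, hμ, rfl⟩ := h f hf
      exact (finite_fwd (ρ := ρ) f μ.snf).subset fun z hz => fwd_of_not_prec hμ hz.2
  refine (Set.finite_iUnion hf).subset ?_
  rintro z ⟨f, hf, hz⟩
  exact Set.mem_iUnion.2 ⟨f, hf, hz⟩

theorem crashed_succ {τ : ℕ} {i : Fin n} (h : ((ρ.state τ).loc i).crashed = true) :
    (ρ.state (τ + 1)).loc i = (ρ.state τ).loc i := by
  have hst := ρ.step τ
  generalize ρ.state τ = c at hst h ⊢
  generalize ρ.state (τ + 1) = c' at hst ⊢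
  generalize ρ.act τ = a at hst
  have key : ∀ {i'}, (c.loc i').crashed = false → i ≠ i' := by
    rintro i' h' rfl
    simp [h] at h'
  cases hst with
  | idle => rfl
  | invoke i' m hcr | ret i' m hcr | scdDeliver i' T hcr | noDeliver i' hcr | crash i' hcr
  | receive j i' μ l hcr | send i' j μ d k hcr =>
    simp [Config.setLoc, Config.setChan, key hcr]

/-- The local state is frozen by the crash, so its counter bounds all the numbers ever given. -/
theorem finite_fwd_of_faulty {f : Fin n} (hf : f ∈ ρ.faulty) :
    {x | ∃ τ ν, ρ.Fwd τ f ν ∧ ν.key = x}.Finite := by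
  obtain ⟨τc, ha⟩ := hf
  have hst := ρ.step τc
  rw [ha] at hst
  have hcr : ((ρ.state (τc + 1)).loc f).crashed = true := by
    generalize ρ.state (τc + 1) = c' at hst
    cases hst with
    | crash _ hcr => simp [Config.setLoc]
  have hp : ∀ t ≥ τc + 1, (ρ.state t).loc f = (ρ.state (τc + 1)).loc f := by
    intro t ht
    induction t, ht using Nat.le_induction with
    | base => rfl
    | succ t ht ih => rw [crashed_succ (by rw [ih, hcr]), ih]
  refine (finite_fwd (ρ := ρ) f (ρ.sn (τc + 1) f)).subset ?_
  rintro x ⟨τ, ν, hν, hk⟩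
  refine ⟨τ, ν, hν, hk, ?_⟩
  have h1 := (hν.mono (le_max_left τ (τc + 1))).snf_le
  have h2 := hp (max τ (τc + 1)) (le_max_right _ _)
  rwa [sn, h2] at h1

end Run

theorem exists_forall_of_mono {α : Type*} {S : Set α} (hS : S.Finite) {P : α → ℕ → Prop}
    (hmono : ∀ x a b, a ≤ b → P x a → P x b) (h : ∀ x ∈ S, ∃ a, P x a) :
    ∃ a, ∀ x ∈ S, P x a := by
  choose! g hg using h
  obtain ⟨a, ha⟩ := (hS.image g).bddAbove
  exact ⟨a, fun x hx => hmono x _ _ (ha ⟨x, hx, rfl⟩) (hg x hx)⟩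

namespace Run

variable {ρ : Run n M}

/-! ### Stuck messages -/

/-- Process `i` forwards `x` and never delivers it. -/
def Stuck (ρ : Run n M) (i : Fin n) (x : Fin n × ℕ) : Prop :=
  (∃ τ μ, ρ.Fwd τ i μ ∧ μ.key = x) ∧ ∀ τ, ¬ ρ.Done τ i x

theorem InBuf.of_no_tryAct {τ τ' : ℕ} {i : Fin n} {x : Fin n × ℕ} (h : ρ.InBuf τ i x)
    (hle : τ ≤ τ') (hno : ∀ e, τ ≤ e → e < τ' → ¬ ρ.TryAct e i) : ρ.InBuf τ' i x := by
  induction τ', hle using Nat.le_induction with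
  | base => exact h
  | succ t ht ih =>
    rcases (ih fun e h1 h2 => hno e h1 (h2.trans (Nat.lt_succ_self _))).succ with
      h | ⟨T, -, -, ha, -⟩
    · exact h
    · exact absurd (.inr ⟨_, ha⟩) (hno t ht (Nat.lt_succ_self _))

open Classical in
/-- A set of messages in which every message precedes, at a majority of the non-faulty processes,
every stuck message outside the set, does not remain stuck. -/
theorem not_forall_stuck (hfair : ρ.IsFair)
    (hmaj : n < 2 * (Finset.univ.filter fun f => f ∉ ρ.faulty).card) {i : Fin n}
    (hi : i ∉ ρ.faulty) {V : Set (Fin n × ℕ)} (hfin : V.Finite) (hne : V.Nonempty)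
    (hV : ∀ x ∈ V, ρ.Stuck i x)
    (hcl : ∀ x ∈ V, ∀ z, ρ.Stuck i z → z ∉ V →
      n < 2 * (Finset.univ.filter fun f => f ∉ ρ.faulty ∧ ρ.Prec f x z).card) : False := by
  have hall : ∀ x ∈ V, ∀ f ∉ ρ.faulty, ∃ τ μ, ρ.Fwd τ f μ ∧ μ.key = x := by
    intro x hx f hf
    obtain ⟨⟨τ, μ, hμ, rfl⟩, -⟩ := hV x hx
    exact exists_fwd hfair hi hf hμ
  obtain ⟨L₁, hL₁⟩ : ∃ L, ∀ p ∈ V ×ˢ {f | f ∉ ρ.faulty}, ∃ μ, ρ.Rcv L p.2 i μ ∧ μ.key = p.1 := by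
    refine exists_forall_of_mono (hfin.prod (Set.toFinite _)) ?_ ?_
    · rintro p a b hab ⟨μ, h1, h2⟩
      exact ⟨μ, h1.mono hab, h2⟩
    · rintro ⟨x, f⟩ ⟨hx, hf⟩
      obtain ⟨τ, μ, hμ, hk⟩ := hall x hx f hf
      obtain ⟨τ', h⟩ := hμ.exists_rcv hfair hf hi
      exact ⟨τ', μ, h, hk⟩
  -- The rivals of `V` are finitely many, and `i` forwards all of them, so those that are not stuck
  -- have all been delivered from some time on.
  obtain ⟨L₂, hL₂⟩ : ∃ L, ∀ z ∈ (⋃ x ∈ V, ρ.Rivals x) \ {z | ρ.Stuck i z}, ρ.Done L i z := by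
    refine exists_forall_of_mono
      ((hfin.biUnion fun x hx => finite_rivals (hall x hx)).subset Set.sdiff_subset) ?_ ?_
    · exact fun x a b hab h => h.mono hab
    · rintro z ⟨hz, hs⟩
      simp only [Set.mem_iUnion] at hz
      obtain ⟨x, hx, f, hf, hz⟩ := hz
      obtain ⟨τ, μ, hμ, rfl⟩ := hall x hx f hf
      obtain ⟨τ₁, ν, hν, rfl, -⟩ := fwd_of_not_prec hμ hz
      have := exists_fwd hfair hf hi hν
      by_contra hno
      exact hs ⟨this, fun τ h => hno ⟨τ, h⟩⟩
  obtain ⟨L, hLL₁, hLL₂⟩ : ∃ L, L₁ ≤ L ∧ L₂ ≤ L := ⟨_, le_max_left _ _, le_max_right _ _⟩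
  obtain ⟨x₀, hx₀⟩ := hne
  -- This `try_deliver` may precede `L`, but then nothing is received or delivered between it and
  -- `L`: all that `i` has received by `L` is already available to it.
  obtain ⟨τ, htry, hquiet⟩ : ∃ τ, ρ.TryAct τ i ∧ ∀ e, τ < e → e < L →
      (∀ f, ρ.act e ≠ .receive f i) ∧ ¬ ρ.TryAct e i := by
    obtain ⟨μ, ⟨τ₀, h1, h2, -⟩, -⟩ := hL₁ (x₀, i) ⟨hx₀, hi⟩
    exact exists_tryAct_quiet hfair hi h2 (h1.trans_le hLL₁)
  have hrcv : ∀ x ∈ V, ∀ f ∉ ρ.faulty, ∃ μ, ρ.Rcv τ f i μ ∧ μ.key = x := by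
    intro x hx f hf
    obtain ⟨μ, ⟨τ', h1, h2, h3⟩, hk⟩ := hL₁ (x, f) ⟨hx, hf⟩
    refine ⟨μ, ⟨τ', ?_, h2, h3⟩, hk⟩
    rcases lt_trichotomy τ' τ with h | rfl | h
    · exact h
    · rcases htry with h | ⟨ms, h⟩ <;> simp [h2] at h
    · exact absurd h2 ((hquiet τ' h (h1.trans_le hLL₁)).1 f)
  have hriv : ∀ x ∈ V, ∀ z ∈ ρ.Rivals x, ρ.InBuf (τ + 1) i z → ρ.Stuck i z := by
    intro x hx z hz hin
    by_contra hs
    have hd := (hL₂ z ⟨Set.mem_biUnion hx hz, hs⟩).mono hLL₂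
    rcases le_total L (τ + 1) with hle | hle
    · exact (hd.mono hle).1 hin
    · exact hd.1 (hin.of_no_tryAct hle fun e h1 h2 => (hquiet e h1 h2).2)
  obtain ⟨T, hT, hb⟩ := htry.inv
  have hlt : ∀ q ∈ ρ.buf τ i, q.key ∈ V → ∀ q' ∈ ρ.buf τ i, ∀ f ∉ ρ.faulty,
      ρ.Prec f q.key q'.key → q.cl f < q'.cl f := by
    rintro q hq hqV q' hq' f hf ⟨t, μ', hμ', hk', hp⟩
    obtain ⟨μ, hr, hk⟩ := hrcv _ hqV f hf
    have hμ : ρ.Fwd τ f μ := Sent.fwd (.inr hr)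
    obtain rfl : μ = μ' := (hμ.mono (le_max_left τ t)).eq_of_key
      (hμ'.mono (le_max_right τ t)) (hk.trans hk'.symm)
    rw [hr.cl_eq hq hk.symm]
    by_cases htop : q'.cl f = ⊤
    · rw [htop]
      exact ENat.natCast_lt_top _
    · obtain ⟨ν, hν, hνk, hc, -⟩ := cl_inv hq' htop
      rw [hc]
      exact_mod_cast hp τ ν hν hνk
  -- The purge loop withdraws nothing from `V`. A `q'` responsible for a withdrawal would lie
  -- outside `V` and stay in the buffer, hence be stuck or no rival; either way the entries of a
  -- majority of non-faulty processes put `q` before `q'`.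
  have hpurge : ∀ T', Relation.ReflTransGen (PurgeStep (ρ.buf τ i)) (candidates (ρ.buf τ i)) T' →
      T ⊆ T' → ∀ q ∈ ρ.buf τ i, q.key ∈ V → q ∈ T' := by
    intro T' h
    induction h with
    | refl =>
      intro _ q hq hqV
      refine Finset.mem_filter.2 ⟨hq, hmaj.trans_le
        (Nat.mul_le_mul_left 2 (Finset.card_le_card ?_))⟩
      intro f hf
      obtain ⟨μ, hr, hk⟩ := hrcv _ hqV f (Finset.mem_filter.1 hf).2
      refine Finset.mem_filter.2 ⟨Finset.mem_univ _, ?_⟩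
      rw [hr.cl_eq hq hk.symm]
      exact ENat.natCast_lt_top _
    | tail _ hs ih =>
      rename_i T₁ T₂ _
      intro hTT q hq hqV
      have hTT₁ := hTT.trans hs.subset
      have ih := ih hTT₁
      obtain ⟨q₁, hq₁, q', hq', hcard, rfl⟩ := hs
      obtain ⟨hq'B, hq'T⟩ := Finset.mem_sdiff.1 hq'
      refine Finset.mem_erase.2 ⟨?_, ih q hq hqV⟩
      rintro rfl
      have hq'V : q'.key ∉ V := fun h => hq'T (ih q' hq'B h)
      have hin : ρ.InBuf (τ + 1) i q'.key := ⟨q', (hb q').2 ⟨hq'B, fun h => hq'T (hTT₁ h)⟩, rfl⟩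
      have hm : n < 2 * (Finset.univ.filter fun f =>
          f ∉ ρ.faulty ∧ ρ.Prec f q.key q'.key).card := by
        by_cases hs : ρ.Stuck i q'.key
        · exact hcl _ hqV _ hs hq'V
        · refine hmaj.trans_le (Nat.mul_le_mul_left 2 (Finset.card_le_card ?_))
          intro f hf
          have hf := (Finset.mem_filter.1 hf).2
          refine Finset.mem_filter.2 ⟨Finset.mem_univ _, hf, ?_⟩
          by_contra hp
          exact hs (hriv _ hqV _ ⟨f, hf, hp⟩ hin)
      refine (hm.trans_le ((Nat.mul_le_mul_left 2 (Finset.card_le_card ?_)).trans hcard)).false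
      intro f hf
      obtain ⟨h1, h2⟩ := (Finset.mem_filter.1 hf).2
      exact Finset.mem_filter.2 ⟨Finset.mem_univ _, hlt q hq hqV q' hq'B f h1 h2⟩
  obtain ⟨μ, hr, hk⟩ := hrcv x₀ hx₀ i hi
  have hμ : ρ.Fwd τ i μ := Sent.fwd (.inr hr)
  refine (hV x₀ hx₀).2 (τ + 1) ⟨?_, μ, hμ.mono (Nat.le_succ _), hk⟩
  rintro ⟨q, hq, hqk⟩
  obtain ⟨h1, h2⟩ := (hb q).1 hq
  exact h2 (hpurge T hT.1 subset_rfl q h1 (hqk ▸ hx₀))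

theorem op_ne_none_of_own {τ : ℕ} {i : Fin n} {x : Fin n × ℕ} (h : ρ.InBuf τ i x)
    (hi : x.1 = i) : ρ.op τ i ≠ none := by
  obtain ⟨q, hq, rfl⟩ := h
  exact (own_mem_buf hq hi).1

open Classical in
/-- A non-faulty process delivers all messages that it forwards. -/
theorem not_stuck (hfair : ρ.IsFair)
    (hmaj : n < 2 * (Finset.univ.filter fun f => f ∉ ρ.faulty).card) {i : Fin n}
    (hi : i ∉ ρ.faulty) (x₀ : Fin n × ℕ) : ¬ ρ.Stuck i x₀ := by
  intro hx₀
  let U : Set (Fin n × ℕ) := {x | ρ.Stuck i x}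
  by_cases hU : U.Finite
  · exact not_forall_stuck hfair hmaj hi hU ⟨x₀, hx₀⟩ (fun x hx => hx)
      fun x _ z hz hzU => absurd hz hzU
  have hall : ∀ x ∈ U, ∀ f ∉ ρ.faulty, ∃ τ μ, ρ.Fwd τ f μ ∧ μ.key = x := by
    rintro x ⟨⟨τ, μ, hμ, rfl⟩, -⟩ f hf
    exact exists_fwd hfair hi hf hμ
  -- A delivery yields a majority among all processes, while `not_forall_stuck` asks for non-faulty
  -- ones. The difference vanishes for messages outside `W`.
  let W : Set (Fin n × ℕ) := {x | ∃ f ∈ ρ.faulty, ∃ τ ν, ρ.Fwd τ f ν ∧ ν.key = x}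
  have hW : W.Finite := by
    refine ((Set.toFinite ρ.faulty).biUnion fun f hf => finite_fwd_of_faulty hf).subset ?_
    rintro x ⟨f, hf, h⟩
    exact Set.mem_biUnion hf h
  -- The set `V` chosen below must contain `W ∩ U`, and with it every stuck message that some
  -- non-faulty process does not forward after a member of `W ∩ U`.
  let Q : Set (Fin n × ℕ) := (W ∩ U) ∪ (⋃ x ∈ W ∩ U, ρ.Rivals x) ∩ U
  have hQU : Q ⊆ U := by
    rintro x (h | h)
    · exact h.2
    · exact h.2
  have hQ : Q.Finite := by
    refine (hW.subset Set.inter_subset_left).union (Set.Finite.subset ?_ Set.inter_subset_left)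
    exact (hW.subset Set.inter_subset_left).biUnion fun x hx => finite_rivals (hall x hx.2)
  -- A message outside `A` follows all of `Q` at every non-faulty process, so no process can deliver
  -- it and leave a member of `Q` for later.
  let A : Set (Fin n × ℕ) := ⋃ x ∈ Q, ρ.Rivals x
  have hA : A.Finite := hQ.biUnion fun x hx => finite_rivals (hall x (hQU hx))
  -- At most one message per sender, hence a finite set to avoid.
  let last : Set (Fin n × ℕ) := {y | (∃ τ μ, ρ.Fwd τ y.1 μ ∧ μ.key = y) ∧
    ¬ ∃ τ μ, ρ.Fwd τ y.1 μ ∧ μ.sd = y.1 ∧ y.2 < μ.snsd}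
  have hlast : last.Finite := by
    refine Set.Finite.of_finite_image (f := Prod.fst) (Set.toFinite _) ?_
    rintro ⟨a, s⟩ ⟨⟨τ, μ, hμ, hk⟩, h1⟩ ⟨b, s'⟩ ⟨⟨τ', μ', hμ', hk'⟩, h2⟩ (rfl : a = b)
    simp only [Forward.key, Prod.mk.injEq] at hk hk'
    rcases lt_trichotomy s s' with h | rfl | h
    · exact absurd ⟨τ', μ', hμ', hk'.1, by simpa [hk'.2] using h⟩ h1
    · rfl
    · exact absurd ⟨τ, μ, hμ, hk.1, by simpa [hk.2] using h⟩ h2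
  obtain ⟨y, hyU, hy⟩ := (Set.Infinite.sdiff hU (hA.union hlast)).nonempty
  rw [Set.mem_union, not_or] at hy
  obtain ⟨hyA, hyl⟩ := hy
  obtain ⟨⟨τy, μy, hμy, hky⟩, -⟩ := id hyU
  have hoy : ∃ τ μ, ρ.Fwd τ y.1 μ ∧ μ.key = y := by
    refine ⟨τy, μy.origin, ?_, hky⟩
    have := hμy.origin
    rwa [← hky]
  obtain ⟨τ', ν, hν, hνs, hνlt⟩ : ∃ τ μ, ρ.Fwd τ y.1 μ ∧ μ.sd = y.1 ∧ y.2 < μ.snsd := by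
    by_contra h
    exact hyl ⟨hoy, h⟩
  -- The sender of `y` invokes scd-broadcast again, so its earlier invocation has returned and `y`
  -- has left its buffer. That sender may be faulty; its deliveries only serve to define `V`.
  obtain ⟨τb, -, hinv, hsn⟩ := hν.invoked
  rw [hνs] at hinv hsn
  have hdone : ρ.Done τb y.1 y := by
    obtain ⟨τ₁, μ₁, hμ₁, hk₁⟩ := hoy
    have hk₁' := hk₁
    simp only [Forward.key, Prod.ext_iff] at hk₁'
    have h1 := hμ₁.snf_eq hk₁'.1
    refine ⟨fun hin => op_ne_none_of_own hin rfl (invoke_inv hinv).2.1, μ₁, ?_, hk₁⟩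
    exact hμ₁.of_snf_lt (by omega)
  obtain ⟨τ₁, -, hdel⟩ := hdone.exists_deliv
  let V : Set (Fin n × ℕ) := {x | x ∈ U ∧ ρ.Done (τ₁ + 1) y.1 x}
  have hQV : Q ⊆ V := by
    intro x hx
    refine ⟨hQU hx, ?_⟩
    by_contra hnd
    obtain ⟨f, h1, h2⟩ := exists_of_majorities hmaj (hdel.majority hnd)
    refine hyA (Set.mem_biUnion hx ⟨f, h1, fun h => h.asymm h2⟩)
  refine not_forall_stuck hfair hmaj hi (V := V) ?_ ⟨y, hyU, hdel.done⟩ (fun x hx => hx.1) ?_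
  · refine (finite_fwd (ρ := ρ) y.1 (ρ.sn (τ₁ + 1) y.1)).subset ?_
    rintro x ⟨-, -, μ, hμ, hk⟩
    exact ⟨_, μ, hμ, hk, hμ.snf_le⟩
  · intro x hx z hz hzV
    by_cases hxW : x ∈ W
    · refine hmaj.trans_le (Nat.mul_le_mul_left 2 (Finset.card_le_card ?_))
      intro f hf
      have hf := (Finset.mem_filter.1 hf).2
      refine Finset.mem_filter.2 ⟨Finset.mem_univ _, hf, ?_⟩
      by_contra hp
      exact hzV (hQV (.inr ⟨Set.mem_biUnion (⟨hxW, hx.1⟩ : x ∈ W ∩ U) ⟨f, hf, hp⟩, hz⟩))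
    -- The sender of `y` delivered `x` before any delivery of `z`. The members of the resulting
    -- majority forward `x`, which is outside `W`, so they are non-faulty.
    · obtain ⟨τx, hlt, hdx⟩ := hx.2.exists_deliv
      have hnz : ¬ ρ.Done (τx + 1) y.1 z := fun h => hzV ⟨hz, h.mono hlt⟩
      refine (hdx.majority hnz).trans_le (Nat.mul_le_mul_left 2 (Finset.card_le_card ?_))
      intro f hf
      have hp := (Finset.mem_filter.1 hf).2
      refine Finset.mem_filter.2 ⟨Finset.mem_univ _, fun hff => hxW ?_, hp⟩
      obtain ⟨t, μ, h1, h2, -⟩ := hp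
      exact ⟨f, hff, t, μ, h1, h2⟩

/-! ### The specification -/

theorem mem_messages {T : Finset (Quadruplet n M)} {m : M} :
    m ∈ messages T ↔ ∃ q ∈ T, q.m = m := by
  simp [messages]

/-- Both forwardings stem from invocations with the same application message, hence from the same
invocation. -/
theorem key_eq_of_m (hd : ρ.DistinctBroadcasts) {τ τ' : ℕ} {i j : Fin n} {μ ν : Forward n M}
    (hμ : ρ.Fwd τ i μ) (hν : ρ.Fwd τ' j ν) (he : μ.m = ν.m) : μ.key = ν.key := by
  obtain ⟨t, -, h1, h2⟩ := hμ.invoked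
  obtain ⟨t', -, h3, h4⟩ := hν.invoked
  rw [he] at h1
  obtain rfl := hd _ _ _ _ _ h1 h3
  rw [h1] at h3
  injection h3 with h5
  simp only [Forward.key, Prod.mk.injEq]
  exact ⟨h5, by rw [← h2, ← h4, h5]⟩

/-- The message `m` in a delivered set is that of a quadruplet leaving the buffer. -/
theorem deliv_of_mem {τ : ℕ} {i : Fin n} {ms : Finset M} {m : M}
    (h : ρ.act τ = .scdDeliver i ms) (hm : m ∈ ms) :
    ∃ μ, ρ.Fwd τ i μ ∧ μ.m = m ∧ ρ.Deliv τ i μ.key := by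
  obtain ⟨T, hT, hb, hne, rfl⟩ := scdDeliver_inv h
  obtain ⟨q, hq, rfl⟩ := mem_messages.1 hm
  obtain ⟨μ, h1, h2, h3⟩ := fwd_of_mem_buf (hT.subset hq)
  exact ⟨μ, h1, h3, T, hT, hb, h, q, hq, h2.symm⟩

theorem Deliv.exists_act {τ τ' : ℕ} {i j : Fin n} {μ : Forward n M} (hμ : ρ.Fwd τ' j μ)
    (h : ρ.Deliv τ i μ.key) : ∃ ms, ρ.act τ = .scdDeliver i ms ∧ μ.m ∈ ms := by
  obtain ⟨T, hT, hb, ha, q, hq, hk⟩ := h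
  obtain ⟨ν, h1, h2, h3⟩ := fwd_of_mem_buf (hT.subset hq)
  exact ⟨_, ha, mem_messages.2 ⟨q, hq, h3.symm.trans (h1.of_key hμ (h2.trans hk))⟩⟩

open Classical in
theorem exists_deliver (hfair : ρ.IsFair)
    (hmaj : n < 2 * (Finset.univ.filter fun f => f ∉ ρ.faulty).card) {i : Fin n}
    (hi : i ∉ ρ.faulty) {τ : ℕ} {μ : Forward n M} (hμ : ρ.Fwd τ i μ) :
    ∃ τ', ρ.Deliv τ' i μ.key := by
  by_contra hno
  refine not_stuck hfair hmaj hi μ.key ⟨⟨τ, μ, hμ, rfl⟩, fun t ht => hno ?_⟩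
  obtain ⟨τ', -, h⟩ := ht.exists_deliv
  exact ⟨τ', h⟩

theorem ret_inv {τ : ℕ} {i : Fin n} {m : M} (h : ρ.act τ = .ret i m) : ρ.op τ i = some m := by
  have hst := ρ.step τ
  rw [h] at hst
  generalize ρ.state (τ + 1) = c' at hst
  cases hst with
  | ret _ _ hcr hctl hop => exact hop

/-- The invocation of scd-broadcast terminates if its message is delivered. -/
theorem exists_ret (hfair : ρ.IsFair) {i : Fin n} (hi : i ∉ ρ.faulty) {τ : ℕ} {m : M}
    (h : ρ.act τ = .invoke i m) (hdone : ∃ t, ρ.Done t i (i, ρ.sn τ i)) :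
    ∃ τ' > τ, ρ.act τ' = .ret i m := by
  by_contra hno
  obtain ⟨-, ho, ho'⟩ := invoke_inv h
  have hop : ∀ t ≥ τ + 1, ρ.op t i = some m := by
    intro t ht
    induction t, ht using Nat.le_induction with
    | base => exact ho'
    | succ t ht ih =>
      have hcall : ∀ {μ k}, ρ.Call t i μ k → ρ.op (t + 1) i = some m := by
        rintro μ k (⟨-, -, -, -, -, -, h, -⟩ | ⟨-, -, h⟩)
        · rw [ih] at h
          cases h
        · rw [h, ih]
      cases ρ.localCase t i with
      | quiet hb hs hc ho => rw [ho, ih]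
      | ret m' ha =>
        have := ret_inv ha
        rw [ih] at this
        injection this with this
        exact absurd ⟨t, by omega, this ▸ ha⟩ hno
      | drop μ k ha => exact hcall ha
      | update μ k ha => exact hcall ha
      | start μ k ha => exact hcall ha
      | send j μ d k ha hk hj hb hc ho => rw [ho, ih]
      | deliver T hT ha hk hk' hb hc hs ho => rw [ho, ih]
  obtain ⟨t₀, hd⟩ := hdone
  obtain ⟨t₁, h1, h2⟩ : ∃ t, t₀ ≤ t ∧ τ + 1 ≤ t := ⟨_, le_max_left _ _, le_max_right _ _⟩
  obtain ⟨τ', h3, h4⟩ := hfair.ret t₁ i m hi (hop t₁ h2) (by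
    rintro t ht ⟨q, hq, hqi⟩
    obtain ⟨ν, hν, hk, -⟩ := fwd_of_mem_buf hq
    have hνi : ν.sd = i := (congrArg Prod.fst hk).trans hqi
    have hin : ρ.InBuf t i ν.key := ⟨q, hq, hk.symm⟩
    -- Older messages of `i` had left the buffer when `op` was `none`; the message itself has been
    -- delivered; a newer one would need an invocation while `op` is `some m`.
    rcases lt_trichotomy ν.snsd (ρ.sn τ i) with hlt | he | hlt
    · have hν' : ρ.Fwd τ i ν := hν.of_snf_lt (by rw [hν.snf_eq hνi]; exact hlt)
      have hd' : ρ.Done τ i ν.key :=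
        ⟨fun h => op_ne_none_of_own h hνi ho, ν, hν', rfl⟩
      exact (hd'.mono (by omega)).1 hin
    · have hk' : ν.key = (i, ρ.sn τ i) := by simp [Forward.key, hνi, he]
      exact (hd.mono (by omega : t₀ ≤ t)).1 (hk' ▸ hin)
    · obtain ⟨s, -, hs1, hs2⟩ := hν.invoked
      rw [hνi] at hs1 hs2
      have hs : τ < s := by
        by_contra hle
        have := sn_mono (ρ := ρ) i (not_lt.1 hle)
        omega
      have := (invoke_inv hs1).2.1
      rw [hop s hs] at this
      cases this)
  exact hno ⟨τ', by omega, h4⟩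

/-! ### Message complexity -/

/-- Two such sends belong to the same forwarding, but whatever has been sent to `k` has a smaller
number than a forwarding still pending for `k`. -/
theorem send_unique (hd : ρ.DistinctBroadcasts) {τ τ' : ℕ} {j k : Fin n} {μ ν : Forward n M}
    (h : ρ.act τ = .send j k μ) (h' : ρ.act τ' = .send j k ν) (he : μ.m = ν.m) : τ = τ' := by
  have aux : ∀ {τ τ' : ℕ} {μ ν : Forward n M}, ρ.act τ = .send j k μ → ρ.act τ' = .send j k ν →
      μ.m = ν.m → ¬ τ < τ' := by
    intro τ τ' μ ν h h' he hlt
    have hs : ρ.Sent τ' j k μ := by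
      clear h' he
      induction τ', (hlt : τ + 1 ≤ τ') using Nat.le_induction with
      | base => exact sent_of_act h
      | succ t ht ih => exact ih.succ
    obtain ⟨d, c, hk, hj⟩ := send_inv h'
    have hν := fwd_of_ctl hk
    obtain rfl := hs.fwd.eq_of_key hν (key_eq_of_m hd hs.fwd hν he)
    have h1 := hs.lt_of_pending hk hj
    have h2 := (sending_inv hk).2.1
    omega
  exact le_antisymm (not_lt.1 (aux h' h he.symm)) (not_lt.1 (aux h h' he))

theorem costPerBroadcastLE (hd : ρ.DistinctBroadcasts) : ρ.CostPerBroadcastLE (n ^ 2) := by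
  constructor
  · intro τ i j μ h
    obtain ⟨d, k, hk, -⟩ := send_inv h
    obtain ⟨τ', h1, h2, -⟩ := (fwd_of_ctl hk).invoked
    exact ⟨τ', h1, h2⟩
  · intro τ i m _
    let S : Set ℕ := {τ' | ∃ j k μ, ρ.act τ' = .send j k μ ∧ μ.m = m}
    have hS : ∀ t : S, ∃ p : Fin n × Fin n, ∃ μ, ρ.act t = .send p.1 p.2 μ ∧ μ.m = m := by
      rintro ⟨t, j, k, μ, h1, h2⟩
      exact ⟨(j, k), μ, h1, h2⟩
    choose g μ hg hm using hS
    have hinj : Function.Injective g := by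
      intro a b hab
      have hb := hg b
      rw [← hab] at hb
      exact Subtype.ext (send_unique hd (hg a) hb ((hm a).trans (hm b).symm))
    have h1 : S.encard ≤ ENat.card (Fin n × Fin n) := ENat.card_le_card_of_injective hinj
    refine h1.trans (le_of_eq ?_)
    simp [sq]

/-! ### Interface history and conclusion -/

theorem history_eq_broadcast {τ : ℕ} {i : Fin n} {m : M} :
    ρ.history τ = some (.broadcast i m) ↔ ρ.act τ = .invoke i m := by
  unfold Run.history
  cases ρ.act τ <;> simp [Action.toScdEvent]

theorem history_eq_returns {τ : ℕ} {i : Fin n} {m : M} :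
    ρ.history τ = some (.returns i m) ↔ ρ.act τ = .ret i m := by
  unfold Run.history
  cases ρ.act τ <;> simp [Action.toScdEvent]

theorem history_eq_deliver {τ : ℕ} {i : Fin n} {ms : Finset M} :
    ρ.history τ = some (.deliver i ms) ↔ ρ.act τ = .scdDeliver i ms := by
  unfold Run.history
  cases ρ.act τ <;> simp [Action.toScdEvent]

open Classical in
theorem isScdBroadcast (hfair : ρ.IsFair) (hd : ρ.DistinctBroadcasts)
    (hmaj : n < 2 * (Finset.univ.filter fun f => f ∉ ρ.faulty).card) :
    IsScdBroadcast ρ.history ρ.faulty := by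
  constructor
  · intro τ i ms h
    obtain ⟨T, -, -, hne, rfl⟩ := scdDeliver_inv (history_eq_deliver.1 h)
    obtain ⟨q, hq⟩ := Finset.nonempty_iff_ne_empty.2 hne
    exact ⟨q.m, mem_messages.2 ⟨q, hq, rfl⟩⟩
  · intro τ i ms m h hm
    obtain ⟨μ, hμ, rfl, -⟩ := deliv_of_mem (history_eq_deliver.1 h) hm
    obtain ⟨τ', h1, h2, -⟩ := hμ.invoked
    exact ⟨τ', h1, μ.sd, history_eq_broadcast.2 h2⟩
  · intro τ τ' i ms ms' m h h' hm hm'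
    obtain ⟨μ, hμ, hμm, hD⟩ := deliv_of_mem (history_eq_deliver.1 h) hm
    obtain ⟨ν, hν, hνm, hD'⟩ := deliv_of_mem (history_eq_deliver.1 h') hm'
    rw [← key_eq_of_m hd hμ hν (hμm.trans hνm.symm)] at hD'
    rcases lt_trichotomy τ τ' with hlt | he | hlt
    · exact absurd hD'.inBuf (hD.done.mono hlt).1
    · exact he
    · exact absurd hD.inBuf (hD'.done.mono hlt).1
  · intro i j m m' τ₁ τ₂ τ₃ τ₄ A B C D h₁ hA h₂ hB hlt h₃ hC h₄ hD hlt'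
    obtain ⟨μ₁, hμ₁, e₁, d₁⟩ := deliv_of_mem (history_eq_deliver.1 h₁) hA
    obtain ⟨μ₂, hμ₂, e₂, d₂⟩ := deliv_of_mem (history_eq_deliver.1 h₂) hB
    obtain ⟨μ₃, hμ₃, e₃, d₃⟩ := deliv_of_mem (history_eq_deliver.1 h₃) hC
    obtain ⟨μ₄, hμ₄, e₄, d₄⟩ := deliv_of_mem (history_eq_deliver.1 h₄) hD
    rw [key_eq_of_m hd hμ₃ hμ₂ (e₃.trans e₂.symm)] at d₃
    rw [key_eq_of_m hd hμ₄ hμ₁ (e₄.trans e₁.symm)] at d₄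
    -- When `i` delivers `m` it has not delivered `m'`, and conversely for `j`; a process common to
    -- the two majorities would order the two messages both ways.
    obtain ⟨f, p, q⟩ := exists_of_majorities
      (d₁.majority fun h => (h.mono hlt).1 d₂.inBuf)
      (d₃.majority fun h => (h.mono hlt').1 d₄.inBuf)
    exact p.asymm q
  · intro τ i m hi h
    have h := history_eq_broadcast.1 h
    have hμ := fwd_of_invoke h
    obtain ⟨t, hD⟩ := exists_deliver hfair hmaj hi hμ
    constructor
    · obtain ⟨τ', h1, h2⟩ := exists_ret hfair hi h ⟨_, hD.done⟩
      exact ⟨τ', h1, history_eq_returns.2 h2⟩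
    · obtain ⟨ms, h1, h2⟩ := hD.exists_act hμ
      exact ⟨t, ms, history_eq_deliver.2 h1, h2⟩
  · intro τ i ms m hi h hm j hj
    obtain ⟨μ, hμ, rfl, -⟩ := deliv_of_mem (history_eq_deliver.1 h) hm
    obtain ⟨t, ν, hν, hk⟩ := exists_fwd hfair hi hj hμ
    obtain ⟨t', hD⟩ := exists_deliver hfair hmaj hj hν
    rw [hk] at hD
    obtain ⟨ms', h1, h2⟩ := hD.exists_act hμ
    exact ⟨t', ms', history_eq_deliver.2 h1, h2⟩

open Classical in
theorem majority_not_faulty {t : ℕ} (ht : 2 * t < n) (h : ρ.faulty.ncard ≤ t) :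
    n < 2 * (Finset.univ.filter fun f => f ∉ ρ.faulty).card := by
  have h1 := Finset.card_filter_add_card_filter_not (s := (Finset.univ : Finset (Fin n)))
    (fun f => f ∈ ρ.faulty)
  have h2 : (Finset.univ.filter fun f => f ∈ ρ.faulty).card = ρ.faulty.ncard := by
    rw [← Set.ncard_coe_finset]
    congr
    ext f
    simp
  rw [Finset.card_univ, Fintype.card_fin] at h1
  omega

end Run
end

end SCD

theorem mainTheorem3 :
    ∃ C : ℕ, ∀ (n t : ℕ) (M : Type*), 2 * t < n →
      ∀ ρ : SCD.Run n M, ρ.IsFair → ρ.faulty.ncard ≤ t → ρ.DistinctBroadcasts →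
        SCD.IsScdBroadcast ρ.history ρ.faulty ∧ ρ.CostPerBroadcastLE (C * n ^ 2) := by
  refine ⟨1, fun n t M ht ρ hfair hfaulty hd => ?_⟩
  rw [one_mul]
  exact ⟨SCD.Run.isScdBroadcast hfair hd (SCD.Run.majority_not_faulty ht hfaulty),
    SCD.Run.costPerBroadcastLE hd⟩
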